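/- Let $A$ be a unital associative complex algebra with centre $Z(A)$. Let $\Omega^1_u(A)=\ker(m\colon A\otimes_{\mathbb C}A\to A)$ be the kernel of the product, an $(A,A)$-bimodule, with the derivation $d_u\colon A\to\Omega^1_u(A)$, $d_u(x)=1\otimes x-x\otimes 1$. Let $\Omega_u(A)$ be the tensor algebra over $A$ of the bimodule $\Omega^1_u(A)$, graded by tensor degree and equipped with the unique differential (antiderivation of degree $1$ and of square zero) which extends $d_u$. Let $\Omega_Z(A)$ be the graded differential algebra obtained as the quotient of $\Omega_u(A)$ by the two-sided ideal generated by $[Z(A),\Omega^1_u(A)]=\{z\omega-\omega z : z\in Z(A),\ \omega\in\Omega^1_u(A)\}$ and $d_u([Z(A),\Omega^1_u(A)])$. Assume that $A$ is commutative. Let $\Omega_{A|\mathbb C}=\Lambda_A\,\Omega^1_{A|\mathbb C}$ be the exterior algebra over $A$ of the module of Kähler differentials of $A$ over $\mathbb C$, graded by exterior degree and equipped with the unique differential which extends the universal derivation $A\to\Omega^1_{A|\mathbb C}$ (the Cartan–de Rham–Kähler algebra). Then there is exactly one isomorphism of graded differential algebras $\Omega_Z(A)\to\Omega_{A|\mathbb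 C}$ (an isomorphism of unital complex algebras which preserves the degree and commutes with the differentials) which induces the identity of $A$ in degree $0$. -/

import Mathlib

universe u

noncomputable section

open scoped TensorProduct DirectSum


/-- An `ℕ`-graded differential algebra over `ℂ`: a unital associative graded algebra with a linear
map `d` of degree `1`, which is an antiderivation and squares to zero. -/
structure GradedDiffAlgebra where
  /-- the underlying set -/
  carrier : Type u
  [ring : Ring carrier]
  [algebra : Algebra ℂ carrier]
  /-- the homogeneous component of each degree -/
  grading : ℕ → Submodule ℂ carrier
  [graded : GradedAlgebra grading]
  /-- the differential -/
  d : carrier →ₗ[ℂ] carrier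
  d_mem : ∀ n, ∀ x ∈ grading n, d x ∈ grading (n + 1)
  d_mul : ∀ n, ∀ x ∈ grading n, ∀ y, d (x * y) = d x * y + (-1 : ℂ) ^ n • (x * d y)
  d_d : ∀ x, d (d x) = 0

namespace GradedDiffAlgebra

attribute [instance] ring algebra graded

instance : CoeSort GradedDiffAlgebra.{u} (Type u) := ⟨carrier⟩

/-- An isomorphism of graded differential algebras: an isomorphism of unital algebras which
preserves the degree and intertwines the differentials. -/
structure Iso (Ω Ω' : GradedDiffAlgebra.{u}) extends Ω ≃ₐ[ℂ] Ω' where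
  map_mem : ∀ n x, x ∈ Ω.grading n ↔ toFun x ∈ Ω'.grading n
  map_d : ∀ x, toFun (Ω.d x) = Ω'.d (toFun x)

instance (Ω Ω' : GradedDiffAlgebra.{u}) : CoeFun (Iso Ω Ω') fun _ => Ω → Ω' :=
  ⟨fun e => e.toAlgEquiv⟩

section Quotient

variable (Ω : GradedDiffAlgebra.{u}) (S : Set Ω)

/-- The closed two-sided ideal generated by `S`, i.e. the two-sided ideal generated by `S` and
`d S`. -/
def closedIdeal : Ideal Ω :=
  (TwoSidedIdeal.span (S ∪ Ω.d '' S)).asIdeal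

instance : (closedIdeal Ω S).IsTwoSided := by
  unfold closedIdeal; infer_instance

variable {Ω S}

theorem isHomogeneousElem_union (hS : ∀ s ∈ S, SetLike.IsHomogeneousElem Ω.grading s) :
    ∀ s ∈ S ∪ Ω.d '' S, SetLike.IsHomogeneousElem Ω.grading s := by
  rintro s (hs | ⟨s, hs, rfl⟩)
  · exact hS s hs
  · obtain ⟨n, hn⟩ := hS s hs
    exact ⟨n + 1, Ω.d_mem n s hn⟩

theorem d_mem_union : ∀ s ∈ S ∪ Ω.d '' S, Ω.d s ∈ closedIdeal Ω S := by
  rintro s (hs | ⟨s, hs, rfl⟩)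
  · exact TwoSidedIdeal.subset_span (Or.inr ⟨s, hs, rfl⟩)
  · rw [Ω.d_d]; exact zero_mem _

theorem closedIdeal_induction (hS : ∀ s ∈ S, SetLike.IsHomogeneousElem Ω.grading s)
    {p : Ω → Prop} (h0 : p 0) (hadd : ∀ x y, p x → p y → p (x + y))
    (h : ∀ k l m, ∀ a ∈ Ω.grading k, ∀ s ∈ Ω.grading l, ∀ b ∈ Ω.grading m,
      s ∈ closedIdeal Ω S → Ω.d s ∈ closedIdeal Ω S → p (a * s * b))
    {x : Ω} (hx : x ∈ closedIdeal Ω S) : p x := by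
  replace hx := TwoSidedIdeal.mem_span_iff_mem_addSubgroup_closure.1 hx
  have key : ∀ a s b : Ω, s ∈ S ∪ Ω.d '' S → p (a * s * b) := by
    intro a s b hs
    obtain ⟨l, hl⟩ := isHomogeneousElem_union hS s hs
    have hs' : s ∈ closedIdeal Ω S := TwoSidedIdeal.subset_span hs
    induction a using DirectSum.Decomposition.inductionOn Ω.grading with
    | zero => simpa using h0
    | add a a' ih ih' => rw [add_mul, add_mul]; exact hadd _ _ ih ih'
    | homogeneous a =>
      induction b using DirectSum.Decomposition.inductionOn Ω.grading with
      | zero => simpa using h0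
      | add b b' ih ih' => rw [mul_add]; exact hadd _ _ ih ih'
      | homogeneous b => exact h _ l _ _ a.2 s hl _ b.2 hs' (d_mem_union s hs)
  induction hx using AddSubgroup.closure_induction'' with
  | zero => exact h0
  | mem x hx =>
    obtain ⟨_, ⟨a, -, s, hs, rfl⟩, b, -, rfl⟩ := hx
    exact key a s b hs
  | neg_mem x hx =>
    obtain ⟨_, ⟨a, -, s, hs, rfl⟩, b, -, rfl⟩ := hx
    have := key (-a) s b hs
    simpa using this
  | add x y _ _ hx hy => exact hadd x y hx hy

theorem d_mem_closedIdeal (hS : ∀ s ∈ S, SetLike.IsHomogeneousElem Ω.grading s)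
    {x : Ω} (hx : x ∈ closedIdeal Ω S) : Ω.d x ∈ closedIdeal Ω S := by
  refine closedIdeal_induction hS (p := fun x => Ω.d x ∈ closedIdeal Ω S) ?_ ?_ ?_ hx
  · rw [map_zero]; exact zero_mem _
  · intro x y hx hy
    rw [map_add]; exact add_mem hx hy
  · intro k l m a ha s hs b hb hs' hds
    rw [mul_assoc, Ω.d_mul k a ha, Ω.d_mul l s hs]
    have hI : ∀ c : ℂ, ∀ z ∈ closedIdeal Ω S, c • z ∈ closedIdeal Ω S := fun c z hz => by
      rw [Algebra.smul_def]; exact Ideal.mul_mem_left _ _ hz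
    refine add_mem (Ideal.mul_mem_left _ _ (Ideal.mul_mem_right _ _ hs')) (hI _ _ ?_)
    exact Ideal.mul_mem_left _ _ (add_mem (Ideal.mul_mem_right _ _ hds)
      (hI _ _ (Ideal.mul_mem_right _ _ hs')))

variable (Ω S)

/-- The quotient map, as a homomorphism of `ℂ`-algebras. -/
def quotMk : Ω →ₐ[ℂ] Ω ⧸ closedIdeal Ω S :=
  Ideal.Quotient.mkₐ ℂ (closedIdeal Ω S)

theorem quotMk_surjective : Function.Surjective (quotMk Ω S) :=
  Ideal.Quotient.mkₐ_surjective ℂ _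

theorem quotMk_eq_zero {x : Ω} : quotMk Ω S x = 0 ↔ x ∈ closedIdeal Ω S :=
  Ideal.Quotient.eq_zero_iff_mem

/-- The degree `n` part of the quotient: the image of the degree `n` part. -/
def quotGrading (n : ℕ) : Submodule ℂ (Ω ⧸ closedIdeal Ω S) :=
  (Ω.grading n).map (quotMk Ω S).toLinearMap

instance : SetLike.GradedMonoid (quotGrading Ω S) where
  one_mem := ⟨1, SetLike.GradedOne.one_mem, map_one (quotMk Ω S)⟩
  mul_mem := by
    rintro i j _ _ ⟨x, hx, rfl⟩ ⟨y, hy, rfl⟩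
    exact ⟨x * y, SetLike.GradedMul.mul_mem hx hy, map_mul (quotMk Ω S) x y⟩

/-- The map from the homogeneous components to those of the quotient. -/
def quotDecomposeAux : Ω →ₗ[ℂ] ⨁ n, quotGrading Ω S n :=
  (DirectSum.toModule ℂ ℕ _ fun n =>
      (DirectSum.lof ℂ ℕ (fun n => quotGrading Ω S n) n).comp
        ((quotMk Ω S).toLinearMap.submoduleMap (Ω.grading n))).comp
    (DirectSum.decomposeLinearEquiv Ω.grading).toLinearMap

theorem quotDecomposeAux_of_mem {n : ℕ} {x : Ω} (hx : x ∈ Ω.grading n) :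
    quotDecomposeAux Ω S x
      = DirectSum.of (fun n => quotGrading Ω S n) n ⟨quotMk Ω S x, x, hx, rfl⟩ := by
  lift x to Ω.grading n using hx
  simp only [quotDecomposeAux, LinearMap.comp_apply, LinearEquiv.coe_coe,
    DirectSum.decomposeLinearEquiv_apply, DirectSum.decompose_coe]
  erw [DirectSum.toModule_lof]
  rfl

variable {S}

/-- The decomposition of an element of the quotient into homogeneous components. -/
def quotDecompose (hS : ∀ s ∈ S, SetLike.IsHomogeneousElem Ω.grading s) :
    (Ω ⧸ closedIdeal Ω S) →+ ⨁ n, quotGrading Ω S n :=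
  QuotientAddGroup.lift (closedIdeal Ω S).toAddSubgroup
    (quotDecomposeAux Ω S).toAddMonoidHom (by
      intro x hx
      replace hx : x ∈ closedIdeal Ω S := hx
      change quotDecomposeAux Ω S x = 0
      refine closedIdeal_induction hS (p := fun x => quotDecomposeAux Ω S x = 0) ?_ ?_ ?_ hx
      · exact map_zero _
      · intro x y hx hy
        rw [map_add, hx, hy, add_zero]
      · intro k l m a ha s hs b hb hs' hds
        rw [quotDecomposeAux_of_mem Ω S
          (SetLike.GradedMul.mul_mem (SetLike.GradedMul.mul_mem ha hs) hb)]
        have : quotMk Ω S (a * s * b) = 0 :=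
          (quotMk_eq_zero Ω S).2 (Ideal.mul_mem_right _ _ (Ideal.mul_mem_left _ _ hs'))
        simp only [this]
        exact map_zero _)

theorem quotDecompose_mk (hS : ∀ s ∈ S, SetLike.IsHomogeneousElem Ω.grading s) (x : Ω) :
    quotDecompose Ω hS (quotMk Ω S x) = quotDecomposeAux Ω S x := rfl

/-- The quotient of a graded differential algebra by the closed two-sided ideal generated by a set
of homogeneous elements. -/
def quot (S : Set Ω) (hS : ∀ s ∈ S, SetLike.IsHomogeneousElem Ω.grading s) :
    GradedDiffAlgebra.{u} where
  carrier := Ω ⧸ closedIdeal Ω S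
  grading := quotGrading Ω S
  graded :=
    { toDecomposition := DirectSum.Decomposition.ofAddHom _ (quotDecompose Ω hS)
        (by
          ext x
          obtain ⟨x, rfl⟩ := quotMk_surjective Ω S x
          induction x using DirectSum.Decomposition.inductionOn Ω.grading with
          | zero => simp
          | add x y hx hy => simp only [map_add, hx, hy]
          | homogeneous x =>
            simp only [AddMonoidHom.comp_apply, quotDecompose_mk,
              quotDecomposeAux_of_mem Ω S x.2, DirectSum.coeAddMonoidHom_of,
              AddMonoidHom.id_apply])
        (by
          refine DirectSum.addHom_ext fun n y => ?_
          obtain ⟨_, x, hx, rfl⟩ := y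
          simp only [AddMonoidHom.comp_apply, DirectSum.coeAddMonoidHom_of, AddMonoidHom.id_apply]
          exact quotDecomposeAux_of_mem Ω S hx) }
  d :=
    { toFun := QuotientAddGroup.map (closedIdeal Ω S).toAddSubgroup
        (closedIdeal Ω S).toAddSubgroup Ω.d.toAddMonoidHom fun _ hx => d_mem_closedIdeal hS hx
      map_add' := fun x y => map_add _ x y
      map_smul' := fun c x => by
        obtain ⟨x, rfl⟩ := quotMk_surjective Ω S x
        exact congrArg (quotMk Ω S) (Ω.d.map_smul c x) |>.trans (map_smul (quotMk Ω S) c (Ω.d x)) }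
  d_mem := by
    rintro n _ ⟨x, hx, rfl⟩
    exact ⟨Ω.d x, Ω.d_mem n x hx, rfl⟩
  d_mul := by
    rintro n _ ⟨x, hx, rfl⟩ y
    obtain ⟨y, rfl⟩ := quotMk_surjective Ω S y
    have := congrArg (quotMk Ω S) (Ω.d_mul n x hx y)
    simp only [map_add, map_mul, map_smul] at this
    exact this
  d_d := by
    intro x
    obtain ⟨x, rfl⟩ := quotMk_surjective Ω S x
    exact (congrArg (quotMk Ω S) (Ω.d_d x)).trans (map_zero _)

end Quotient

end GradedDiffAlgebra

section BimoduleTensorAlgebra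

variable (A M : Type u) [Ring A] [Algebra ℂ A] [AddCommGroup M] [Module ℂ M]
  [Module A M] [Module Aᵐᵒᵖ M]

/-- The relations which turn the free `ℂ`-algebra on the vector space `A × M` into the tensor
algebra over `A` of the `(A, A)`-bimodule `M`. -/
inductive BimoduleTensorAlgebra.Rel :
    TensorAlgebra ℂ (A × M) → TensorAlgebra ℂ (A × M) → Prop
  | one : Rel (TensorAlgebra.ι ℂ (1, 0)) 1
  | mul (a b : A) : Rel (TensorAlgebra.ι ℂ (a, 0) * TensorAlgebra.ι ℂ (b, 0))
      (TensorAlgebra.ι ℂ (a * b, 0))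
  | left (a : A) (m : M) : Rel (TensorAlgebra.ι ℂ (a, 0) * TensorAlgebra.ι ℂ (0, m))
      (TensorAlgebra.ι ℂ (0, a • m))
  | right (m : M) (a : A) : Rel (TensorAlgebra.ι ℂ (0, m) * TensorAlgebra.ι ℂ (a, 0))
      (TensorAlgebra.ι ℂ (0, MulOpposite.op a • m))

/-- The tensor algebra `T_A(M) = A ⊕ M ⊕ (M ⊗_A M) ⊕ ⋯` over the (possibly noncommutative)
algebra `A` of an `(A, A)`-bimodule `M`: the universal `ℂ`-algebra with an algebra homomorphism
from `A` and a bimodule homomorphism from `M`. The right action of `a` on `m` is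
`MulOpposite.op a • m`. -/
def BimoduleTensorAlgebra : Type u := RingQuot (BimoduleTensorAlgebra.Rel A M)

namespace BimoduleTensorAlgebra

instance : Ring (BimoduleTensorAlgebra A M) :=
  inferInstanceAs (Ring (RingQuot (Rel A M)))

instance : Algebra ℂ (BimoduleTensorAlgebra A M) :=
  inferInstanceAs (Algebra ℂ (RingQuot (Rel A M)))

/-- The quotient map from the free algebra. -/
def ofFree : TensorAlgebra ℂ (A × M) →ₐ[ℂ] BimoduleTensorAlgebra A M :=
  RingQuot.mkAlgHom ℂ (Rel A M)

theorem ofFree_rel {x y : TensorAlgebra ℂ (A × M)} (h : Rel A M x y) :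
    ofFree A M x = ofFree A M y :=
  RingQuot.mkAlgHom_rel ℂ h

/-- The canonical homomorphism of `A` into `T_A(M)`. -/
def ofAlg : A →ₐ[ℂ] BimoduleTensorAlgebra A M :=
  AlgHom.ofLinearMap
    ((ofFree A M).toLinearMap.comp ((TensorAlgebra.ι ℂ).comp (LinearMap.inl ℂ A M)))
    ((ofFree_rel A M Rel.one).trans (map_one _))
    (fun a b => (ofFree_rel A M (Rel.mul a b)).symm.trans (map_mul _ _ _))

/-- The canonical map of `M` into `T_A(M)`. -/
def ofMod : M →ₗ[ℂ] BimoduleTensorAlgebra A M :=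
  (ofFree A M).toLinearMap.comp ((TensorAlgebra.ι ℂ).comp (LinearMap.inr ℂ A M))

variable {A M}

theorem ofMod_smul (a : A) (m : M) : ofMod A M (a • m) = ofAlg A M a * ofMod A M m :=
  (ofFree_rel A M (Rel.left a m)).symm.trans (map_mul _ _ _)

theorem ofMod_op_smul (a : A) (m : M) :
    ofMod A M (MulOpposite.op a • m) = ofMod A M m * ofAlg A M a :=
  (ofFree_rel A M (Rel.right m a)).symm.trans (map_mul _ _ _)

section lift

variable {B : Type*} [Semiring B] [Algebra ℂ B]

/-- The universal property of `T_A(M)`. -/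
def lift (f : A →ₐ[ℂ] B) (g : M →ₗ[ℂ] B) (hl : ∀ a m, g (a • m) = f a * g m)
    (hr : ∀ a m, g (MulOpposite.op a • m) = g m * f a) : BimoduleTensorAlgebra A M →ₐ[ℂ] B :=
  RingQuot.liftAlgHom ℂ ⟨TensorAlgebra.lift ℂ (f.toLinearMap.coprod g), by
    rintro _ _ (_ | ⟨a, b⟩ | ⟨a, m⟩ | ⟨m, a⟩) <;> simp [hl, hr]⟩

@[simp] theorem lift_ofAlg (f : A →ₐ[ℂ] B) (g : M →ₗ[ℂ] B) (hl : ∀ a m, g (a • m) = f a * g m)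
    (hr : ∀ a m, g (MulOpposite.op a • m) = g m * f a) (a : A) :
    lift f g hl hr (ofAlg A M a) = f a := by
  change RingQuot.liftAlgHom ℂ _ (RingQuot.mkAlgHom ℂ _ (TensorAlgebra.ι ℂ (a, 0))) = f a
  rw [RingQuot.liftAlgHom_mkAlgHom_apply]
  simp

@[simp] theorem lift_ofMod (f : A →ₐ[ℂ] B) (g : M →ₗ[ℂ] B) (hl : ∀ a m, g (a • m) = f a * g m)
    (hr : ∀ a m, g (MulOpposite.op a • m) = g m * f a) (m : M) :
    lift f g hl hr (ofMod A M m) = g m := by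
  change RingQuot.liftAlgHom ℂ _ (RingQuot.mkAlgHom ℂ _ (TensorAlgebra.ι ℂ (0, m))) = g m
  rw [RingQuot.liftAlgHom_mkAlgHom_apply]
  simp

theorem hom_ext {f g : BimoduleTensorAlgebra A M →ₐ[ℂ] B}
    (hA : ∀ a, f (ofAlg A M a) = g (ofAlg A M a)) (hM : ∀ m, f (ofMod A M m) = g (ofMod A M m)) :
    f = g := by
  apply RingQuot.ringQuot_ext' ℂ
  apply TensorAlgebra.hom_ext
  refine LinearMap.prod_ext ?_ ?_
  · ext a; exact hA a
  · ext m; exact hM m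

end lift

theorem induction {p : BimoduleTensorAlgebra A M → Prop} (hA : ∀ a, p (ofAlg A M a))
    (hM : ∀ m, p (ofMod A M m)) (hadd : ∀ x y, p x → p y → p (x + y))
    (hmul : ∀ x y, p x → p y → p (x * y)) (x : BimoduleTensorAlgebra A M) : p x := by
  let S : Subalgebra ℂ (BimoduleTensorAlgebra A M) :=
    { carrier := {x | p x}
      mul_mem' := fun {x y} hx hy => hmul x y hx hy
      add_mem' := fun {x y} hx hy => hadd x y hx hy
      algebraMap_mem' := fun r => by
        have := hA (algebraMap ℂ A r)
        rwa [AlgHom.commutes] at this }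
  obtain ⟨t, rfl⟩ : ∃ t, ofFree A M t = x := RingQuot.mkAlgHom_surjective ℂ _ x
  change ofFree A M t ∈ S
  induction t using TensorAlgebra.induction with
  | algebraMap r => rw [AlgHom.commutes]; exact S.algebraMap_mem r
  | ι v =>
    obtain ⟨a, m⟩ := v
    have h : ((a, m) : A × M) = (a, 0) + (0, m) := by simp
    rw [h, map_add, map_add]
    exact S.add_mem (hA a) (hM m)
  | mul x y hx hy => rw [map_mul]; exact S.mul_mem hx hy
  | add x y hx hy => rw [map_add]; exact S.add_mem hx hy

variable (A M)

/-- The degree `n` part `M ⊗_A ⋯ ⊗_A M` of `T_A(M)`, spanned by the products `a m₁ ⋯ mₙ`. -/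
def grading (n : ℕ) : Submodule ℂ (BimoduleTensorAlgebra A M) :=
  LinearMap.range (ofAlg A M).toLinearMap * LinearMap.range (ofMod A M) ^ n

variable {A M}

theorem ofAlg_mem (a : A) : ofAlg A M a ∈ grading A M 0 := by
  rw [grading, pow_zero, mul_one]
  exact ⟨a, rfl⟩

theorem ofMod_mem (m : M) : ofMod A M m ∈ grading A M 1 := by
  rw [grading, pow_one, ← one_mul (ofMod A M m)]
  exact Submodule.mul_mem_mul ⟨1, map_one (ofAlg A M)⟩ ⟨m, rfl⟩

theorem pow_mul_range_le (n : ℕ) :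
    LinearMap.range (ofMod A M) ^ n * LinearMap.range (ofAlg A M).toLinearMap ≤
      LinearMap.range (ofAlg A M).toLinearMap * LinearMap.range (ofMod A M) ^ n := by
  have h1 : LinearMap.range (ofMod A M) * LinearMap.range (ofAlg A M).toLinearMap ≤
      LinearMap.range (ofAlg A M).toLinearMap * LinearMap.range (ofMod A M) := by
    rw [Submodule.mul_le]
    rintro _ ⟨m, rfl⟩ _ ⟨a, rfl⟩
    rw [AlgHom.toLinearMap_apply, ← ofMod_op_smul, ← one_mul (ofMod A M _)]
    exact Submodule.mul_mem_mul ⟨1, map_one (ofAlg A M)⟩ ⟨_, rfl⟩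
  induction n with
  | zero => simp
  | succ n ih =>
    calc _ = LinearMap.range (ofMod A M) ^ n *
          (LinearMap.range (ofMod A M) * LinearMap.range (ofAlg A M).toLinearMap) := by
            rw [pow_succ, mul_assoc]
      _ ≤ LinearMap.range (ofMod A M) ^ n *
          (LinearMap.range (ofAlg A M).toLinearMap * LinearMap.range (ofMod A M)) :=
            mul_le_mul_right h1 _
      _ = LinearMap.range (ofMod A M) ^ n * LinearMap.range (ofAlg A M).toLinearMap *
            LinearMap.range (ofMod A M) := by rw [mul_assoc]
      _ ≤ LinearMap.range (ofAlg A M).toLinearMap * LinearMap.range (ofMod A M) ^ n *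
            LinearMap.range (ofMod A M) := mul_le_mul_left ih _
      _ = _ := by rw [pow_succ, mul_assoc]

instance : SetLike.GradedMonoid (grading A M) where
  one_mem := by
    have := ofAlg_mem (M := M) (1 : A)
    rwa [map_one] at this
  mul_mem := by
    intro i j x y hx hy
    have h0 : LinearMap.range (ofAlg A M).toLinearMap * LinearMap.range (ofAlg A M).toLinearMap ≤
        LinearMap.range (ofAlg A M).toLinearMap := by
      rw [Submodule.mul_le]
      rintro _ ⟨a, rfl⟩ _ ⟨b, rfl⟩
      exact ⟨a * b, map_mul (ofAlg A M) a b⟩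
    have h : grading A M i * grading A M j ≤ grading A M (i + j) := by
      unfold grading
      calc _ = LinearMap.range (ofAlg A M).toLinearMap *
            (LinearMap.range (ofMod A M) ^ i * LinearMap.range (ofAlg A M).toLinearMap) *
              LinearMap.range (ofMod A M) ^ j := by simp only [mul_assoc]
        _ ≤ LinearMap.range (ofAlg A M).toLinearMap *
            (LinearMap.range (ofAlg A M).toLinearMap * LinearMap.range (ofMod A M) ^ i) *
              LinearMap.range (ofMod A M) ^ j :=
            mul_le_mul_left (mul_le_mul_right (pow_mul_range_le i) _) _
        _ = LinearMap.range (ofAlg A M).toLinearMap * LinearMap.range (ofAlg A M).toLinearMap *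
            (LinearMap.range (ofMod A M) ^ i * LinearMap.range (ofMod A M) ^ j) := by
            simp only [mul_assoc]
        _ ≤ _ := by
            rw [pow_add]
            exact mul_le_mul_left h0 _
    exact h (Submodule.mul_mem_mul hx hy)

/-- A family of subspaces which is multiplicative and contains the generators in the appropriate
degrees contains the homogeneous components. -/
theorem grading_le (N : ℕ → Submodule ℂ (BimoduleTensorAlgebra A M))
    (hA : ∀ a, ofAlg A M a ∈ N 0) (hM : ∀ m, ofMod A M m ∈ N 1)
    (hmul : ∀ i j, ∀ x ∈ N i, ∀ y ∈ N j, x * y ∈ N (i + j)) (n : ℕ) : grading A M n ≤ N n := by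
  induction n with
  | zero =>
    rw [grading, pow_zero, mul_one]
    rintro _ ⟨a, rfl⟩
    exact hA a
  | succ n ih =>
    rw [grading, pow_succ, ← mul_assoc, Submodule.mul_le]
    rintro x hx _ ⟨m, rfl⟩
    exact hmul n 1 x (ih hx) _ (hM m)

/-- The inclusion of `A` as the degree `0` summand. -/
def decomposeAlg : A →ₐ[ℂ] ⨁ n, grading A M n :=
  AlgHom.ofLinearMap
    ((DirectSum.lof ℂ ℕ (fun n => grading A M n) 0).comp
      ((ofAlg A M).toLinearMap.codRestrict _ ofAlg_mem))
    (congrArg (DirectSum.of (fun n => grading A M n) 0) (Subtype.ext (map_one (ofAlg A M))))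
    (fun a b => by
      change DirectSum.of (fun n => grading A M n) 0 _ =
        DirectSum.of (fun n => grading A M n) 0 _ * DirectSum.of (fun n => grading A M n) 0 _
      rw [DirectSum.of_mul_of]
      exact DirectSum.of_eq_of_gradedMonoid_eq
        (Sigma.subtype_ext (zero_add _).symm (map_mul (ofAlg A M) a b)))

/-- The inclusion of `M` as the degree `1` summand. -/
def decomposeMod : M →ₗ[ℂ] ⨁ n, grading A M n :=
  (DirectSum.lof ℂ ℕ (fun n => grading A M n) 1).comp ((ofMod A M).codRestrict _ ofMod_mem)

/-- The map of `T_A(M)` into the direct sum of its homogeneous components. -/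
def decomposeHom : BimoduleTensorAlgebra A M →ₐ[ℂ] ⨁ n, grading A M n :=
  lift decomposeAlg decomposeMod
    (fun a m => by
      change DirectSum.of (fun n => grading A M n) 1 _ =
        DirectSum.of (fun n => grading A M n) 0 _ * DirectSum.of (fun n => grading A M n) 1 _
      rw [DirectSum.of_mul_of]
      exact DirectSum.of_eq_of_gradedMonoid_eq
        (Sigma.subtype_ext (zero_add _).symm (ofMod_smul a m)))
    (fun a m => by
      change DirectSum.of (fun n => grading A M n) 1 _ =
        DirectSum.of (fun n => grading A M n) 1 _ * DirectSum.of (fun n => grading A M n) 0 _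
      rw [DirectSum.of_mul_of]
      exact DirectSum.of_eq_of_gradedMonoid_eq
        (Sigma.subtype_ext (add_zero _).symm (ofMod_op_smul a m)))

theorem decomposeHom_coe (n : ℕ) (x : grading A M n) :
    decomposeHom (x : BimoduleTensorAlgebra A M) = DirectSum.of (fun n => grading A M n) n x := by
  let N (n : ℕ) : Submodule ℂ (BimoduleTensorAlgebra A M) :=
    { carrier := {x | ∃ h : x ∈ grading A M n,
        decomposeHom x = DirectSum.of (fun n => grading A M n) n ⟨x, h⟩}
      zero_mem' := ⟨zero_mem _, (map_zero _).trans (map_zero _).symm⟩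
      add_mem' := by
        rintro x y ⟨hx, hx'⟩ ⟨hy, hy'⟩
        refine ⟨add_mem hx hy, ?_⟩
        rw [map_add, hx', hy', ← map_add]
        rfl
      smul_mem' := by
        rintro c x ⟨hx, hx'⟩
        refine ⟨Submodule.smul_mem _ c hx, ?_⟩
        rw [map_smul, hx']
        exact ((DirectSum.lof ℂ ℕ (fun n => grading A M n) n).map_smul c ⟨x, hx⟩).symm }
  have h : x.1 ∈ N n := by
    refine grading_le N (fun a => ⟨ofAlg_mem a, ?_⟩) (fun m => ⟨ofMod_mem m, ?_⟩) ?_ n x.2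
    · exact lift_ofAlg _ _ _ _ a
    · exact lift_ofMod _ _ _ _ m
    · rintro i j x ⟨hx, hx'⟩ y ⟨hy, hy'⟩
      refine ⟨SetLike.GradedMul.mul_mem hx hy, ?_⟩
      rw [map_mul, hx', hy', DirectSum.of_mul_of]
      rfl
  exact h.2

instance : GradedAlgebra (grading A M) :=
  GradedAlgebra.ofAlgHom _ decomposeHom
    (by
      refine hom_ext (fun a => ?_) (fun m => ?_)
      · simp only [decomposeHom, AlgHom.comp_apply, lift_ofAlg]
        exact DirectSum.coeAlgHom_of (grading A M) 0 ⟨ofAlg A M a, ofAlg_mem a⟩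
      · simp only [decomposeHom, AlgHom.comp_apply, lift_ofMod]
        exact DirectSum.coeAlgHom_of (grading A M) 1 ⟨ofMod A M m, ofMod_mem m⟩)
    decomposeHom_coe

end BimoduleTensorAlgebra

end BimoduleTensorAlgebra

section UniversalCalculus

variable (A : Type u) [Ring A] [Algebra ℂ A]

/-- The `(A, A)`-bimodule `Ω¹_u(A)`: the kernel of the product `A ⊗ A → A`. -/
def UniversalForms1 : Type u := LinearMap.ker (LinearMap.mul' ℂ A)

namespace UniversalForms1

instance : AddCommGroup (UniversalForms1 A) :=
  inferInstanceAs (AddCommGroup (LinearMap.ker (LinearMap.mul' ℂ A)))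

instance : Module ℂ (UniversalForms1 A) :=
  inferInstanceAs (Module ℂ (LinearMap.ker (LinearMap.mul' ℂ A)))

/-- The inclusion of `Ω¹_u(A)` in `A ⊗ A`. -/
def incl : UniversalForms1 A →ₗ[ℂ] A ⊗[ℂ] A := (LinearMap.ker (LinearMap.mul' ℂ A)).subtype

variable {A}

theorem incl_injective : Function.Injective (incl A) := Subtype.val_injective

theorem mul'_incl (ω : UniversalForms1 A) : LinearMap.mul' ℂ A (incl A ω) = 0 := ω.2

theorem mul'_left (a : A) (t : A ⊗[ℂ] A) :
    LinearMap.mul' ℂ A ((a ⊗ₜ 1) * t) = a * LinearMap.mul' ℂ A t := by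
  induction t with
  | zero => simp
  | tmul x y => simp [mul_assoc]
  | add x y hx hy => simp only [mul_add, map_add, hx, hy]

theorem mul'_right (a : A) (t : A ⊗[ℂ] A) :
    LinearMap.mul' ℂ A (t * (1 ⊗ₜ a)) = LinearMap.mul' ℂ A t * a := by
  induction t with
  | zero => simp
  | tmul x y => simp [mul_assoc]
  | add x y hx hy => simp only [add_mul, map_add, hx, hy]

/-- The left action `a (x ⊗ y) = a x ⊗ y`. -/
instance : SMul A (UniversalForms1 A) where
  smul a ω := ⟨(a ⊗ₜ 1) * incl A ω, by
    rw [LinearMap.mem_ker, mul'_left, mul'_incl, mul_zero]⟩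

/-- The right action `(x ⊗ y) a = x ⊗ y a`. -/
instance : SMul Aᵐᵒᵖ (UniversalForms1 A) where
  smul a ω := ⟨incl A ω * (1 ⊗ₜ a.unop), by
    rw [LinearMap.mem_ker, mul'_right, mul'_incl, zero_mul]⟩

theorem incl_smul (a : A) (ω : UniversalForms1 A) : incl A (a • ω) = (a ⊗ₜ 1) * incl A ω := rfl

theorem incl_op_smul (a : Aᵐᵒᵖ) (ω : UniversalForms1 A) :
    incl A (a • ω) = incl A ω * (1 ⊗ₜ a.unop) := rfl

instance : Module A (UniversalForms1 A) where
  one_smul ω := incl_injective (by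
    rw [incl_smul, ← Algebra.TensorProduct.one_def, one_mul])
  mul_smul a b ω := incl_injective (by
    simp only [incl_smul, ← mul_assoc, Algebra.TensorProduct.tmul_mul_tmul, one_mul])
  smul_zero a := incl_injective (by simp only [incl_smul, map_zero, mul_zero])
  smul_add a ω η := incl_injective (by simp only [incl_smul, map_add, mul_add])
  add_smul a b ω := incl_injective (by
    simp only [incl_smul, map_add, TensorProduct.add_tmul, add_mul])
  zero_smul ω := incl_injective (by
    simp only [incl_smul, map_zero, TensorProduct.zero_tmul, zero_mul])

instance : Module Aᵐᵒᵖ (UniversalForms1 A) where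
  one_smul ω := incl_injective (by
    rw [incl_op_smul, MulOpposite.unop_one, ← Algebra.TensorProduct.one_def, mul_one])
  mul_smul a b ω := incl_injective (by
    simp only [incl_op_smul, mul_assoc, Algebra.TensorProduct.tmul_mul_tmul, one_mul,
      MulOpposite.unop_mul])
  smul_zero a := incl_injective (by simp only [incl_op_smul, map_zero, zero_mul])
  smul_add a ω η := incl_injective (by simp only [incl_op_smul, map_add, add_mul])
  add_smul a b ω := incl_injective (by
    simp only [incl_op_smul, map_add, MulOpposite.unop_add, TensorProduct.tmul_add, mul_add])
  zero_smul ω := incl_injective (by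
    simp only [incl_op_smul, map_zero, MulOpposite.unop_zero, TensorProduct.tmul_zero, mul_zero])

instance : SMulCommClass A Aᵐᵒᵖ (UniversalForms1 A) where
  smul_comm a b ω := incl_injective (by simp only [incl_smul, incl_op_smul, mul_assoc])

instance : IsScalarTower ℂ A (UniversalForms1 A) where
  smul_assoc c a ω := incl_injective (by
    simp only [incl_smul, map_smul, ← TensorProduct.smul_tmul', smul_mul_assoc])

instance : IsScalarTower ℂ Aᵐᵒᵖ (UniversalForms1 A) where
  smul_assoc c a ω := incl_injective (by
    simp only [incl_op_smul, map_smul, MulOpposite.unop_smul, TensorProduct.tmul_smul,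
      mul_smul_comm])

variable (A)

/-- The universal derivation `d_u x = 1 ⊗ x - x ⊗ 1`. -/
def d : A →ₗ[ℂ] UniversalForms1 A :=
  (TensorProduct.mk ℂ A A 1 - (TensorProduct.mk ℂ A A).flip 1).codRestrict
    (LinearMap.ker (LinearMap.mul' ℂ A)) fun x => by simp

variable {A}

theorem incl_d (x : A) : incl A (d A x) = 1 ⊗ₜ x - x ⊗ₜ 1 := rfl

theorem d_mul (x y : A) : d A (x * y) = MulOpposite.op y • d A x + x • d A y :=
  incl_injective (by
    simp only [map_add, incl_d, incl_smul, incl_op_smul, MulOpposite.unop_op, sub_mul, mul_sub,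
      Algebra.TensorProduct.tmul_mul_tmul, one_mul, mul_one]
    abel)

theorem d_one : d A 1 = 0 := incl_injective (by simp [incl_d])

end UniversalForms1

namespace UniversalForms

open BimoduleTensorAlgebra

/-- The tensor algebra over `A` of the bimodule `Ω¹_u(A)`. -/
abbrev Carrier : Type u := BimoduleTensorAlgebra A (UniversalForms1 A)

/-- The inclusion of `A`. -/
abbrev ofA : A →ₐ[ℂ] Carrier A := ofAlg A (UniversalForms1 A)

/-- The inclusion of `Ω¹_u(A)`. -/
abbrev of1 : UniversalForms1 A →ₗ[ℂ] Carrier A := ofMod A (UniversalForms1 A)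

/-- The map `x ⊗ y ↦ d_u(x) d_u(y)`. -/
def dTensor : A ⊗[ℂ] A →ₗ[ℂ] Carrier A :=
  TensorProduct.lift
    ((LinearMap.mul ℂ (Carrier A)).compl₁₂ ((of1 A).comp (UniversalForms1.d A))
      ((of1 A).comp (UniversalForms1.d A)))

variable {A}

theorem dTensor_tmul (x y : A) : dTensor A (x ⊗ₜ y) =
    of1 A (UniversalForms1.d A x) * of1 A (UniversalForms1.d A y) := rfl

theorem of1_d_mul (x y : A) : of1 A (UniversalForms1.d A (x * y)) =
    of1 A (UniversalForms1.d A x) * ofA A y + ofA A x * of1 A (UniversalForms1.d A y) := by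
  rw [UniversalForms1.d_mul, map_add, ofMod_smul, ofMod_op_smul]

/-- For `∑ x ⊗ y` in the kernel of the product, `∑ x d_u(y) = ∑ x ⊗ y`. -/
theorem dTensor_left_aux (a : A) (t : A ⊗[ℂ] A) :
    ∃ ω : UniversalForms1 A, UniversalForms1.incl A ω = t - LinearMap.mul' ℂ A t ⊗ₜ 1 ∧
      dTensor A ((a ⊗ₜ 1) * t) = of1 A (UniversalForms1.d A a) * of1 A ω +
        ofA A a * dTensor A t := by
  induction t with
  | zero => exact ⟨0, by simp, by simp⟩
  | tmul x y =>
    refine ⟨x • UniversalForms1.d A y, ?_, ?_⟩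
    · simp [UniversalForms1.incl_smul, UniversalForms1.incl_d, mul_sub]
    · rw [Algebra.TensorProduct.tmul_mul_tmul, one_mul, dTensor_tmul, dTensor_tmul, of1_d_mul,
        ofMod_smul]
      noncomm_ring
  | add s t hs ht =>
    obtain ⟨ω, h1, h2⟩ := hs
    obtain ⟨η, h3, h4⟩ := ht
    refine ⟨ω + η, ?_, ?_⟩
    · rw [map_add, h1, h3, map_add, TensorProduct.add_tmul]; abel
    · rw [mul_add, map_add, h2, h4, map_add, map_add]; noncomm_ring

/-- For `∑ x ⊗ y` in the kernel of the product, `∑ d_u(x) y = - ∑ x ⊗ y`. -/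
theorem dTensor_right_aux (a : A) (t : A ⊗[ℂ] A) :
    ∃ ω : UniversalForms1 A, UniversalForms1.incl A ω = 1 ⊗ₜ LinearMap.mul' ℂ A t - t ∧
      dTensor A (t * (1 ⊗ₜ a)) = dTensor A t * ofA A a +
        of1 A ω * of1 A (UniversalForms1.d A a) := by
  induction t with
  | zero => exact ⟨0, by simp, by simp⟩
  | tmul x y =>
    refine ⟨MulOpposite.op y • UniversalForms1.d A x, ?_, ?_⟩
    · simp [UniversalForms1.incl_op_smul, UniversalForms1.incl_d, sub_mul]
    · rw [Algebra.TensorProduct.tmul_mul_tmul, mul_one, dTensor_tmul, dTensor_tmul, of1_d_mul,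
        ofMod_op_smul]
      noncomm_ring
  | add s t hs ht =>
    obtain ⟨ω, h1, h2⟩ := hs
    obtain ⟨η, h3, h4⟩ := ht
    refine ⟨ω + η, ?_, ?_⟩
    · rw [map_add, h1, h3, map_add, TensorProduct.tmul_add]; abel
    · rw [add_mul, map_add, h2, h4, map_add, map_add]; noncomm_ring

variable (A)

/-- The differential on `Ω¹_u(A)`: `∑ x ⊗ y = ∑ x d_u(y) ↦ ∑ d_u(x) d_u(y)`. -/
def d1 : UniversalForms1 A →ₗ[ℂ] Carrier A := (dTensor A).comp (UniversalForms1.incl A)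

variable {A}

theorem d1_smul (a : A) (ω : UniversalForms1 A) : d1 A (a • ω) =
    of1 A (UniversalForms1.d A a) * of1 A ω + ofA A a * d1 A ω := by
  obtain ⟨η, h1, h2⟩ := dTensor_left_aux a (UniversalForms1.incl A ω)
  rw [UniversalForms1.mul'_incl, TensorProduct.zero_tmul, sub_zero] at h1
  rw [UniversalForms1.incl_injective h1] at h2
  exact h2

theorem d1_op_smul (a : A) (ω : UniversalForms1 A) : d1 A (MulOpposite.op a • ω) =
    d1 A ω * ofA A a - of1 A ω * of1 A (UniversalForms1.d A a) := by
  obtain ⟨η, h1, h2⟩ := dTensor_right_aux a (UniversalForms1.incl A ω)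
  rw [UniversalForms1.mul'_incl, TensorProduct.tmul_zero, zero_sub, ← map_neg] at h1
  rw [UniversalForms1.incl_injective h1, map_neg, neg_mul, ← sub_eq_add_neg] at h2
  exact h2

theorem d1_d (a : A) : d1 A (UniversalForms1.d A a) = 0 := by
  change dTensor A (UniversalForms1.incl A (UniversalForms1.d A a)) = 0
  rw [UniversalForms1.incl_d, map_sub, dTensor_tmul, dTensor_tmul, UniversalForms1.d_one]
  simp

variable (A)

/-- On `A`, the matrix `[[a, d a], [0, a]]`. -/
def matA : A →ₐ[ℂ] Matrix (Fin 2) (Fin 2) (Carrier A) :=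
  AlgHom.ofLinearMap
    { toFun := fun a => !![ofA A a, of1 A (UniversalForms1.d A a); 0, ofA A a]
      map_add' := fun a b => by
        ext i j; fin_cases i <;> fin_cases j <;> simp
      map_smul' := fun c a => by
        ext i j; fin_cases i <;> fin_cases j <;> simp }
    (by
      ext i j; fin_cases i <;> fin_cases j <;> simp [UniversalForms1.d_one])
    (fun a b => by
      ext i j
      fin_cases i <;> fin_cases j <;> simp [Matrix.mul_apply, Fin.sum_univ_two, of1_d_mul]
      abel)

/-- On `Ω¹_u(A)`, the matrix `[[-ω, d ω], [0, ω]]`. -/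
def mat1 : UniversalForms1 A →ₗ[ℂ] Matrix (Fin 2) (Fin 2) (Carrier A) where
  toFun := fun ω => !![-of1 A ω, d1 A ω; 0, of1 A ω]
  map_add' := fun a b => by
    ext i j; fin_cases i <;> fin_cases j <;> simp
    abel
  map_smul' := fun c a => by
    ext i j; fin_cases i <;> fin_cases j <;> simp

/-- The algebra homomorphism `x ↦ [[σ x, d x], [0, x]]`, where `σ x = (-1)ⁿ x` in degree `n`.
Its multiplicativity is the antiderivation property `d (x y) = d x y + σ x d y`. -/
def matHom : Carrier A →ₐ[ℂ] Matrix (Fin 2) (Fin 2) (Carrier A) :=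
  lift (matA A) (mat1 A)
    (fun a ω => by
      ext i j
      fin_cases i <;> fin_cases j <;>
        simp [matA, mat1, Matrix.mul_apply, Fin.sum_univ_two, ofMod_smul, d1_smul]
      abel)
    (fun a ω => by
      ext i j
      fin_cases i <;> fin_cases j <;>
        simp [matA, mat1, Matrix.mul_apply, Fin.sum_univ_two, ofMod_op_smul, d1_op_smul]
      abel)

/-- The differential `d_u` of `Ω_u(A)`: the antiderivation which extends `d_u : A → Ω¹_u(A)` and
vanishes on `d_u A`. -/
def d : Carrier A →ₗ[ℂ] Carrier A where
  toFun x := matHom A x 0 1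
  map_add' x y := by simp
  map_smul' c x := by simp

variable {A}

theorem d_ofA (a : A) : d A (ofA A a) = of1 A (UniversalForms1.d A a) := by
  simp [d, matHom, matA]

theorem d_of1 (ω : UniversalForms1 A) : d A (of1 A ω) = d1 A ω := by
  simp [d, matHom, mat1]

theorem matHom_one_zero (x : Carrier A) : matHom A x 1 0 = 0 := by
  induction x using BimoduleTensorAlgebra.induction with
  | hA a => simp [matHom, matA]
  | hM m => simp [matHom, mat1]
  | hadd x y hx hy => simp [hx, hy]
  | hmul x y hx hy => simp [Matrix.mul_apply, Fin.sum_univ_two, hx, hy]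

theorem matHom_one_one (x : Carrier A) : matHom A x 1 1 = x := by
  induction x using BimoduleTensorAlgebra.induction with
  | hA a => simp [matHom, matA]
  | hM m => simp [matHom, mat1]
  | hadd x y hx hy => simp [hx, hy]
  | hmul x y hx hy => simp [Matrix.mul_apply, Fin.sum_univ_two, hx, hy, matHom_one_zero]

theorem matHom_zero_zero (n : ℕ) (x : Carrier A) (hx : x ∈ grading A (UniversalForms1 A) n) :
    matHom A x 0 0 = (-1 : ℂ) ^ n • x := by
  let N (n : ℕ) : Submodule ℂ (Carrier A) :=
    { carrier := {x | matHom A x 0 0 = (-1 : ℂ) ^ n • x}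
      zero_mem' := by simp
      add_mem' := by
        intro x y hx hy
        simp only [Set.mem_ofPred_eq] at hx hy ⊢
        simp [hx, hy]
      smul_mem' := by
        intro c x hx
        simp only [Set.mem_ofPred_eq] at hx ⊢
        rw [map_smul, Matrix.smul_apply, hx, smul_comm] }
  refine grading_le N (fun a => ?_) (fun m => ?_) ?_ n hx
  · change matHom A (ofA A a) 0 0 = (-1 : ℂ) ^ 0 • ofA A a
    simp [matHom, matA]
  · change matHom A (of1 A m) 0 0 = (-1 : ℂ) ^ 1 • of1 A m
    simp [matHom, mat1]
  · intro i j x (hx : matHom A x 0 0 = _) y (hy : matHom A y 0 0 = _)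
    change matHom A (x * y) 0 0 = (-1 : ℂ) ^ (i + j) • (x * y)
    rw [map_mul, Matrix.mul_apply, Fin.sum_univ_two, matHom_one_zero, hx, hy, mul_zero, add_zero,
      smul_mul_smul_comm, pow_add]

theorem d_mul (n : ℕ) (x : Carrier A) (hx : x ∈ grading A (UniversalForms1 A) n)
    (y : Carrier A) : d A (x * y) = d A x * y + (-1 : ℂ) ^ n • (x * d A y) := by
  change matHom A (x * y) 0 1 = matHom A x 0 1 * y + (-1 : ℂ) ^ n • (x * matHom A y 0 1)
  rw [map_mul, Matrix.mul_apply, Fin.sum_univ_two, matHom_zero_zero n x hx, matHom_one_one,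
    smul_mul_assoc, add_comm]

theorem d1_mem (ω : UniversalForms1 A) : d1 A ω ∈ grading A (UniversalForms1 A) 2 := by
  change dTensor A (UniversalForms1.incl A ω) ∈ _
  induction UniversalForms1.incl A ω with
  | zero => rw [map_zero]; exact zero_mem _
  | tmul x y =>
    rw [dTensor_tmul]
    have h := SetLike.GradedMul.mul_mem (A := grading A (UniversalForms1 A))
      (ofMod_mem (UniversalForms1.d A x)) (ofMod_mem (UniversalForms1.d A y))
    rwa [one_add_one_eq_two] at h
  | add s t hs ht => rw [map_add]; exact add_mem hs ht

theorem d_mem (n : ℕ) (x : Carrier A) (hx : x ∈ grading A (UniversalForms1 A) n) :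
    d A x ∈ grading A (UniversalForms1 A) (n + 1) := by
  let N (n : ℕ) : Submodule ℂ (Carrier A) :=
    grading A (UniversalForms1 A) n ⊓ (grading A (UniversalForms1 A) (n + 1)).comap (d A)
  refine (grading_le N (fun a => ?_) (fun m => ?_) ?_ n hx).2
  · refine ⟨ofAlg_mem a, ?_⟩
    rw [SetLike.mem_coe, Submodule.mem_comap, d_ofA]
    exact ofMod_mem _
  · refine ⟨ofMod_mem m, ?_⟩
    rw [SetLike.mem_coe, Submodule.mem_comap, d_of1]
    exact d1_mem m
  · rintro i j x ⟨hx, hx'⟩ y ⟨hy, hy'⟩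
    refine ⟨SetLike.GradedMul.mul_mem hx hy, ?_⟩
    rw [SetLike.mem_coe, Submodule.mem_comap] at *
    rw [d_mul i x hx]
    refine add_mem ?_ (Submodule.smul_mem _ _ ?_)
    · have := SetLike.GradedMul.mul_mem hx' hy
      rwa [add_right_comm] at this
    · have := SetLike.GradedMul.mul_mem hx hy'
      rwa [← add_assoc] at this

theorem d_d (x : Carrier A) : d A (d A x) = 0 := by
  have hdd : ∀ t : A ⊗[ℂ] A, d A (dTensor A t) = 0 := by
    intro t
    induction t with
    | zero => simp
    | tmul x y =>
      rw [dTensor_tmul, d_mul 1 _ (ofMod_mem _), d_of1, d_of1, d1_d, d1_d]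
      simp
    | add s t hs ht => rw [map_add, map_add, hs, ht, add_zero]
  let N (n : ℕ) : Submodule ℂ (Carrier A) :=
    grading A (UniversalForms1 A) n ⊓ LinearMap.ker ((d A).comp (d A))
  have hN : ∀ n, grading A (UniversalForms1 A) n ≤ N n := by
    intro n
    refine grading_le N (fun a => ⟨ofAlg_mem a, ?_⟩) (fun m => ⟨ofMod_mem m, ?_⟩) ?_ n
    · change d A (d A (ofA A a)) = 0
      rw [d_ofA, d_of1, d1_d]
    · change d A (d A (of1 A m)) = 0
      rw [d_of1]
      exact hdd _
    · rintro i j x ⟨hx, hx'⟩ y ⟨hy, hy'⟩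
      replace hx' : d A (d A x) = 0 := hx'
      replace hy' : d A (d A y) = 0 := hy'
      refine ⟨SetLike.GradedMul.mul_mem hx hy, ?_⟩
      change d A (d A (x * y)) = 0
      rw [d_mul i x hx, map_add, map_smul, d_mul (i + 1) _ (d_mem i x hx), d_mul i x hx, hx', hy',
        pow_succ]
      simp
  induction x using DirectSum.Decomposition.inductionOn (grading A (UniversalForms1 A)) with
  | zero => simp
  | homogeneous x => exact (hN _ x.2).2
  | add x y hx hy => rw [map_add, map_add, hx, hy, add_zero]

end UniversalForms

/-- The universal differential calculus `Ω_u(A)`: the tensor algebra over `A` of the bimodule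
`Ω¹_u(A)`, with the differential which extends `d_u : A → Ω¹_u(A)`. -/
def UniversalForms : GradedDiffAlgebra.{u} where
  carrier := UniversalForms.Carrier A
  grading := BimoduleTensorAlgebra.grading A (UniversalForms1 A)
  d := UniversalForms.d A
  d_mem := UniversalForms.d_mem
  d_mul := UniversalForms.d_mul
  d_d := UniversalForms.d_d

/-- The commutators `z ω - ω z` with `z` in the center of `A` and `ω` in `Ω¹_u(A)`. -/
def centralCommutators : Set (UniversalForms A) :=
  {x | ∃ z ∈ Subalgebra.center ℂ A, ∃ ω : UniversalForms1 A,
    x = UniversalForms.of1 A (z • ω - MulOpposite.op z • ω)}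

/-- The differential calculus `Ω_Z(A)`: the quotient of `Ω_u(A)` by the closed two-sided ideal
generated by `[Z(A), Ω¹_u(A)]`. -/
def CentralForms : GradedDiffAlgebra.{u} :=
  (UniversalForms A).quot (centralCommutators A) (by
    rintro _ ⟨z, -, ω, rfl⟩
    exact ⟨1, BimoduleTensorAlgebra.ofMod_mem _⟩)

/-- The canonical homomorphism of `A` onto the degree `0` part of `Ω_Z(A)`. -/
def CentralForms.ofA : A →ₐ[ℂ] CentralForms A :=
  ((UniversalForms A).quotMk (centralCommutators A)).comp (UniversalForms.ofA A)

end UniversalCalculus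

section KaehlerForms

variable (A : Type u) [CommRing A] [Algebra ℂ A]

namespace KaehlerForms

open KaehlerDifferential

/-- The exterior algebra over `A` of the module of Kähler differentials. -/
abbrev Carrier : Type u := ExteriorAlgebra A (Ω[A⁄ℂ])

/-- The inclusion of the Kähler differentials. -/
abbrev of1 : Ω[A⁄ℂ] →ₗ[A] Carrier A := ExteriorAlgebra.ι A

/-- The degree `n` part, the `n`-th exterior power over `A`, as a complex vector space. -/
def grading (n : ℕ) : Submodule ℂ (Carrier A) := (⋀[A]^n (Ω[A⁄ℂ])).restrictScalars ℂ

instance : SetLike.GradedMonoid (grading A) where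
  one_mem := SetLike.GradedOne.one_mem (A := fun n : ℕ => ⋀[A]^n (Ω[A⁄ℂ]))
  mul_mem _ _ _ _ hx hy := SetLike.GradedMul.mul_mem (A := fun n : ℕ => ⋀[A]^n (Ω[A⁄ℂ])) hx hy

instance : GradedAlgebra (grading A) where
  decompose' := DirectSum.Decomposition.decompose' (ℳ := fun n : ℕ => ⋀[A]^n (Ω[A⁄ℂ]))
  left_inv := DirectSum.Decomposition.left_inv (ℳ := fun n : ℕ => ⋀[A]^n (Ω[A⁄ℂ]))
  right_inv := DirectSum.Decomposition.right_inv (ℳ := fun n : ℕ => ⋀[A]^n (Ω[A⁄ℂ]))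

variable {A}

theorem algebraMap_mem (a : A) : algebraMap A (Carrier A) a ∈ grading A 0 :=
  SetLike.algebraMap_mem_graded (fun n : ℕ => ⋀[A]^n (Ω[A⁄ℂ])) a

theorem of1_mem (ω : Ω[A⁄ℂ]) : of1 A ω ∈ grading A 1 := by
  change of1 A ω ∈ LinearMap.range (ExteriorAlgebra.ι A) ^ 1
  rw [pow_one]
  exact ⟨ω, rfl⟩

theorem grading_le (N : ℕ → Submodule ℂ (Carrier A))
    (hA : ∀ a, algebraMap A (Carrier A) a ∈ N 0) (h1 : ∀ ω, of1 A ω ∈ N 1)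
    (hmul : ∀ i j, ∀ x ∈ N i, ∀ y ∈ N j, x * y ∈ N (i + j)) (n : ℕ) : grading A n ≤ N n := by
  induction n with
  | zero =>
    intro x hx
    change x ∈ LinearMap.range (ExteriorAlgebra.ι A) ^ 0 at hx
    rw [pow_zero, Submodule.mem_one] at hx
    obtain ⟨a, rfl⟩ := hx
    exact hA a
  | succ n ih =>
    intro x hx
    change x ∈ LinearMap.range (ExteriorAlgebra.ι A) ^ (n + 1) at hx
    rw [pow_succ] at hx
    refine Submodule.mul_induction_on hx ?_ fun x y hx hy => add_mem hx hy
    rintro x hx _ ⟨ω, rfl⟩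
    exact hmul n 1 x (ih hx) _ (h1 ω)

theorem of1_anticomm (ω η : Ω[A⁄ℂ]) : of1 A ω * of1 A η = -(of1 A η * of1 A ω) :=
  eq_neg_of_add_eq_zero_left (ExteriorAlgebra.ι_add_mul_swap ω η)

variable (A)

/-- The map `∑ x ⊗ y ↦ ∑ d x ∧ d y`, where the formal sum of the `x ⊗ y` stands for `∑ x d y`. -/
def preD : (A →₀ A) →+ Carrier A :=
  Finsupp.liftAddHom fun y =>
    { toFun := fun x => of1 A (D ℂ A x) * of1 A (D ℂ A y)
      map_zero' := by simp
      map_add' := fun x x' => by simp [add_mul] }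

variable {A}

theorem preD_single (x y : A) : preD A (Finsupp.single y x) =
    of1 A (D ℂ A x) * of1 A (D ℂ A y) := by
  simp [preD]

theorem preD_smul (a : A) (f : A →₀ A) : preD A (a • f) =
    of1 A (D ℂ A a) * of1 A (Finsupp.linearCombination A (D ℂ A) f) + a • preD A f := by
  induction f using Finsupp.induction_linear with
  | zero => simp
  | add f g hf hg => rw [smul_add, map_add, hf, hg, map_add, map_add, map_add]; simp [mul_add]; abel
  | single y x =>
    rw [Finsupp.smul_single, preD_single, preD_single, smul_eq_mul, Derivation.leibniz,
      Finsupp.linearCombination_single]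
    simp only [map_add, map_smul, add_mul, smul_mul_assoc, mul_smul_comm]
    abel

theorem preD_eq_zero (f : A →₀ A) (hf : f ∈ kerTotal ℂ A) : preD A f = 0 := by
  have hker : ∀ g ∈ kerTotal ℂ A, Finsupp.linearCombination A (D ℂ A) g = 0 := fun g hg => by
    rw [← kerTotal_eq] at hg
    exact hg
  unfold kerTotal at hf
  induction hf using Submodule.span_induction with
  | zero => exact map_zero _
  | add f g _ _ hf hg => rw [map_add, hf, hg, add_zero]
  | smul a f hf' hf => rw [preD_smul, hker f hf', hf]; simp
  | mem f hf =>
    obtain ((⟨⟨x, y⟩, rfl⟩ | ⟨⟨x, y⟩, rfl⟩) | ⟨x, rfl⟩) := hf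
    · simp [preD_single]
    · simp only [map_sub, map_add, preD_single, Derivation.map_one_eq_zero, map_zero, zero_mul,
        sub_zero]
      rw [of1_anticomm]
      abel
    · simp [preD_single]

variable (A)

/-- The differential on `1`-forms, `∑ x d y ↦ ∑ d x ∧ d y`. -/
def d1 : Ω[A⁄ℂ] →+ Carrier A :=
  (QuotientAddGroup.lift (kerTotal ℂ A).toAddSubgroup (preD A) preD_eq_zero).comp
    (quotKerTotalEquiv ℂ A).symm.toLinearMap.toAddMonoidHom

variable {A}

theorem d1_linearCombination (f : A →₀ A) :
    d1 A (Finsupp.linearCombination A (D ℂ A) f) = preD A f := by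
  have h : (quotKerTotalEquiv ℂ A).symm (Finsupp.linearCombination A (D ℂ A) f) =
      (kerTotal ℂ A).mkQ f := by
    rw [LinearEquiv.symm_apply_eq]
    rfl
  change QuotientAddGroup.lift (kerTotal ℂ A).toAddSubgroup (preD A) preD_eq_zero
    ((quotKerTotalEquiv ℂ A).symm (Finsupp.linearCombination A (D ℂ A) f)) = _
  rw [h]
  rfl

theorem d1_smul (a : A) (ω : Ω[A⁄ℂ]) :
    d1 A (a • ω) = of1 A (D ℂ A a) * of1 A ω + a • d1 A ω := by
  obtain ⟨f, rfl⟩ := linearCombination_surjective ℂ A ω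
  rw [← map_smul, d1_linearCombination, d1_linearCombination, preD_smul]

theorem d1_D (a : A) : d1 A (D ℂ A a) = 0 := by
  have h := d1_linearCombination (Finsupp.single a (1 : A))
  simpa [preD_single] using h

/-- Induction on `1`-forms through the differentials of products of functions. -/
theorem d1_induction {p : Carrier A → Prop} (h0 : p 0) (hadd : ∀ x y, p x → p y → p (x + y))
    (h : ∀ a b, p (of1 A (D ℂ A a) * of1 A (D ℂ A b))) (ω : Ω[A⁄ℂ]) : p (d1 A ω) := by
  obtain ⟨f, rfl⟩ := linearCombination_surjective ℂ A ω
  rw [d1_linearCombination]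
  induction f using Finsupp.induction_linear with
  | zero => rwa [map_zero]
  | add f g hf hg => rw [map_add]; exact hadd _ _ hf hg
  | single y x => rw [preD_single]; exact h x y

theorem of1_mul_d1 (η ω : Ω[A⁄ℂ]) : of1 A η * d1 A ω = d1 A ω * of1 A η := by
  refine d1_induction (p := fun x => of1 A η * x = x * of1 A η) ?_ ?_ ?_ ω
  · simp
  · intro x y hx hy; rw [mul_add, add_mul, hx, hy]
  · intro a b
    rw [← mul_assoc, of1_anticomm η, neg_mul, mul_assoc, of1_anticomm η, mul_neg, neg_neg,
      mul_assoc]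

variable (A)

/-- On `A`, the matrix `[[a, d a], [0, a]]`. -/
def matA : A →+* Matrix (Fin 2) (Fin 2) (Carrier A) where
  toFun a := !![algebraMap A _ a, of1 A (D ℂ A a); 0, algebraMap A _ a]
  map_zero' := by ext i j; fin_cases i <;> fin_cases j <;> simp
  map_add' a b := by ext i j; fin_cases i <;> fin_cases j <;> simp
  map_one' := by ext i j; fin_cases i <;> fin_cases j <;> simp
  map_mul' a b := by
    ext i j
    fin_cases i <;> fin_cases j <;>
      simp [Matrix.mul_apply, Fin.sum_univ_two, Algebra.smul_def, Algebra.commutes b]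

/-- The `2 × 2` matrices over the exterior algebra which commute with the image of `A`. -/
def Mat : Type u := Subring.centralizer (Set.range (matA A))

instance : Ring (Mat A) := inferInstanceAs (Ring (Subring.centralizer (Set.range (matA A))))

/-- The underlying matrix. -/
def Mat.val : Mat A →+* Matrix (Fin 2) (Fin 2) (Carrier A) :=
  (Subring.centralizer (Set.range (matA A))).subtype

variable {A} in
theorem Mat.val_injective : Function.Injective (Mat.val A) := Subtype.val_injective

/-- The homomorphism of `A` into the center of `Mat A`. -/
def Mat.ofA : A →+* Mat A :=
  (matA A).codRestrict (Subring.centralizer (Set.range (matA A))) (by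
    intro a
    rw [Subring.mem_centralizer_iff]
    rintro _ ⟨b, rfl⟩
    rw [← map_mul, mul_comm, map_mul])

theorem Mat.val_ofA (a : A) : Mat.val A (Mat.ofA A a) = matA A a := rfl

instance : Algebra A (Mat A) :=
  (Mat.ofA A).toAlgebra' (by
    rintro a ⟨x, hx⟩
    exact Subtype.ext (Subring.mem_centralizer_iff.1 hx _ ⟨a, rfl⟩))

theorem Mat.val_smul (a : A) (x : Mat A) : Mat.val A (a • x) = matA A a * Mat.val A x := rfl

theorem Mat.val_algebraMap (a : A) : Mat.val A (algebraMap A (Mat A) a) = matA A a := rfl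

/-- On the Kähler differentials, the matrix `[[-ω, d ω], [0, ω]]`. -/
def mat1Fun (ω : Ω[A⁄ℂ]) : Mat A :=
  ⟨!![-of1 A ω, d1 A ω; 0, of1 A ω], by
    rw [Subring.mem_centralizer_iff]
    rintro _ ⟨a, rfl⟩
    ext i j
    fin_cases i <;> fin_cases j <;>
      simp [matA, Matrix.mul_apply, Fin.sum_univ_two, Algebra.commutes a]
    rw [of1_anticomm, add_comm]⟩

theorem Mat.val_mat1Fun (ω : Ω[A⁄ℂ]) :
    Mat.val A (mat1Fun A ω) = !![-of1 A ω, d1 A ω; 0, of1 A ω] := rfl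

/-- The map `mat1Fun` is `A`-linear. -/
def mat1 : Ω[A⁄ℂ] →ₗ[A] Mat A where
  toFun := mat1Fun A
  map_add' ω η := Mat.val_injective (by
    simp only [map_add, Mat.val_mat1Fun]
    ext i j
    fin_cases i <;> fin_cases j <;> simp
    abel)
  map_smul' a ω := Mat.val_injective (by
    simp only [RingHom.id_apply, Mat.val_smul, Mat.val_mat1Fun]
    ext i j
    fin_cases i <;> fin_cases j <;>
      simp [matA, Matrix.mul_apply, Fin.sum_univ_two, d1_smul, Algebra.smul_def, add_comm])

theorem Mat.val_mat1 (ω : Ω[A⁄ℂ]) :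
    Mat.val A (mat1 A ω) = !![-of1 A ω, d1 A ω; 0, of1 A ω] := rfl

/-- The homomorphism `x ↦ [[σ x, d x], [0, x]]`, where `σ x = (-1)ⁿ x` in degree `n`. Its
multiplicativity is the antiderivation property `d (x y) = d x y + σ x d y`. -/
def matHom : Carrier A →+* Matrix (Fin 2) (Fin 2) (Carrier A) :=
  (Mat.val A).comp (ExteriorAlgebra.lift A ⟨mat1 A, fun ω => Mat.val_injective (by
    rw [map_mul, map_zero, Mat.val_mat1]
    ext i j
    fin_cases i <;> fin_cases j <;>
      simp [Matrix.mul_apply, Fin.sum_univ_two, of1_mul_d1])⟩ : Carrier A →ₐ[A] Mat A).toRingHom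

variable {A}

theorem matHom_algebraMap (a : A) : matHom A (algebraMap A _ a) =
    !![algebraMap A _ a, of1 A (D ℂ A a); 0, algebraMap A _ a] := by
  change Mat.val A (ExteriorAlgebra.lift A _ (algebraMap A _ a)) = _
  rw [AlgHom.commutes, Mat.val_algebraMap]
  rfl

theorem matHom_of1 (ω : Ω[A⁄ℂ]) : matHom A (of1 A ω) =
    !![-of1 A ω, d1 A ω; 0, of1 A ω] := by
  change Mat.val A (ExteriorAlgebra.lift A _ (ExteriorAlgebra.ι A ω)) = _
  rw [ExteriorAlgebra.lift_ι_apply, Mat.val_mat1]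

theorem matHom_smul (c : ℂ) (x : Carrier A) : matHom A (c • x) = c • matHom A x := by
  have h : matHom A (algebraMap A _ (algebraMap ℂ A c)) = algebraMap ℂ _ c := by
    rw [matHom_algebraMap]
    ext i j
    fin_cases i <;> fin_cases j <;>
      simp [Matrix.algebraMap_matrix_apply, ← IsScalarTower.algebraMap_apply]
  rw [Algebra.smul_def, IsScalarTower.algebraMap_apply ℂ A, map_mul, h, ← Algebra.smul_def]

variable (A)

/-- The exterior differential: the antiderivation which extends the universal derivation
`A → Ω[A⁄ℂ]` and vanishes on exact `1`-forms. -/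
def d : Carrier A →ₗ[ℂ] Carrier A where
  toFun x := matHom A x 0 1
  map_add' x y := by simp
  map_smul' c x := by simp [matHom_smul]

variable {A}

theorem d_algebraMap (a : A) : d A (algebraMap A _ a) = of1 A (D ℂ A a) := by
  change matHom A (algebraMap A _ a) 0 1 = _
  simp [matHom_algebraMap]

theorem d_of1 (ω : Ω[A⁄ℂ]) : d A (of1 A ω) = d1 A ω := by
  change matHom A (of1 A ω) 0 1 = _
  simp [matHom_of1]

theorem matHom_one_zero (x : Carrier A) : matHom A x 1 0 = 0 := by
  induction x using ExteriorAlgebra.induction with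
  | algebraMap a => simp [matHom_algebraMap]
  | ι m => simp [matHom_of1]
  | add x y hx hy => simp [hx, hy]
  | mul x y hx hy => simp [Matrix.mul_apply, Fin.sum_univ_two, hx, hy]

theorem matHom_one_one (x : Carrier A) : matHom A x 1 1 = x := by
  induction x using ExteriorAlgebra.induction with
  | algebraMap a => simp [matHom_algebraMap]
  | ι m => simp [matHom_of1]
  | add x y hx hy => simp [hx, hy]
  | mul x y hx hy => simp [Matrix.mul_apply, Fin.sum_univ_two, hx, hy, matHom_one_zero]

theorem matHom_zero_zero (n : ℕ) (x : Carrier A) (hx : x ∈ grading A n) :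
    matHom A x 0 0 = (-1 : ℂ) ^ n • x := by
  let N (n : ℕ) : Submodule ℂ (Carrier A) :=
    { carrier := {x | matHom A x 0 0 = (-1 : ℂ) ^ n • x}
      zero_mem' := by simp
      add_mem' := by
        intro x y hx hy
        simp only [Set.mem_ofPred_eq] at hx hy ⊢
        simp [hx, hy]
      smul_mem' := by
        intro c x hx
        simp only [Set.mem_ofPred_eq] at hx ⊢
        rw [matHom_smul, Matrix.smul_apply, hx, smul_comm] }
  refine grading_le N (fun a => ?_) (fun m => ?_) ?_ n hx
  · change matHom A (algebraMap A _ a) 0 0 = (-1 : ℂ) ^ 0 • algebraMap A _ a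
    simp [matHom_algebraMap]
  · change matHom A (of1 A m) 0 0 = (-1 : ℂ) ^ 1 • of1 A m
    simp [matHom_of1]
  · intro i j x (hx : matHom A x 0 0 = _) y (hy : matHom A y 0 0 = _)
    change matHom A (x * y) 0 0 = (-1 : ℂ) ^ (i + j) • (x * y)
    rw [map_mul, Matrix.mul_apply, Fin.sum_univ_two, matHom_one_zero, hx, hy, mul_zero, add_zero,
      smul_mul_smul_comm, pow_add]

theorem d_mul (n : ℕ) (x : Carrier A) (hx : x ∈ grading A n)
    (y : Carrier A) : d A (x * y) = d A x * y + (-1 : ℂ) ^ n • (x * d A y) := by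
  change matHom A (x * y) 0 1 = matHom A x 0 1 * y + (-1 : ℂ) ^ n • (x * matHom A y 0 1)
  rw [map_mul, Matrix.mul_apply, Fin.sum_univ_two, matHom_zero_zero n x hx, matHom_one_one,
    smul_mul_assoc, add_comm]

theorem d1_mem (ω : Ω[A⁄ℂ]) : d1 A ω ∈ grading A 2 := by
  refine d1_induction (p := fun x => x ∈ grading A 2) (zero_mem _) (fun _ _ => add_mem) ?_ ω
  intro a b
  have h := SetLike.GradedMul.mul_mem (A := grading A) (of1_mem (D ℂ A a)) (of1_mem (D ℂ A b))
  rwa [one_add_one_eq_two] at h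

theorem d_mem (n : ℕ) (x : Carrier A) (hx : x ∈ grading A n) : d A x ∈ grading A (n + 1) := by
  let N (n : ℕ) : Submodule ℂ (Carrier A) := grading A n ⊓ (grading A (n + 1)).comap (d A)
  refine (grading_le N (fun a => ?_) (fun m => ?_) ?_ n hx).2
  · refine ⟨algebraMap_mem a, ?_⟩
    rw [SetLike.mem_coe, Submodule.mem_comap, d_algebraMap]
    exact of1_mem _
  · refine ⟨of1_mem m, ?_⟩
    rw [SetLike.mem_coe, Submodule.mem_comap, d_of1]
    exact d1_mem m
  · rintro i j x ⟨hx, hx'⟩ y ⟨hy, hy'⟩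
    refine ⟨SetLike.GradedMul.mul_mem hx hy, ?_⟩
    rw [SetLike.mem_coe, Submodule.mem_comap] at *
    rw [d_mul i x hx]
    refine add_mem ?_ (Submodule.smul_mem _ _ ?_)
    · have := SetLike.GradedMul.mul_mem hx' hy
      rwa [add_right_comm] at this
    · have := SetLike.GradedMul.mul_mem hx hy'
      rwa [← add_assoc] at this

theorem d_d (x : Carrier A) : d A (d A x) = 0 := by
  have hdd : ∀ ω, d A (d1 A ω) = 0 := by
    intro ω
    refine d1_induction (p := fun x => d A x = 0) (map_zero _) ?_ ?_ ω
    · intro x y hx hy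
      rw [map_add, hx, hy, add_zero]
    · intro a b
      rw [d_mul 1 _ (of1_mem _), d_of1, d_of1, d1_D, d1_D]
      simp
  let N (n : ℕ) : Submodule ℂ (Carrier A) := grading A n ⊓ LinearMap.ker ((d A).comp (d A))
  have hN : ∀ n, grading A n ≤ N n := by
    intro n
    refine grading_le N (fun a => ⟨algebraMap_mem a, ?_⟩) (fun m => ⟨of1_mem m, ?_⟩) ?_ n
    · change d A (d A (algebraMap A _ a)) = 0
      rw [d_algebraMap, d_of1, d1_D]
    · change d A (d A (of1 A m)) = 0
      rw [d_of1]
      exact hdd _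
    · rintro i j x ⟨hx, hx'⟩ y ⟨hy, hy'⟩
      replace hx' : d A (d A x) = 0 := hx'
      replace hy' : d A (d A y) = 0 := hy'
      refine ⟨SetLike.GradedMul.mul_mem hx hy, ?_⟩
      change d A (d A (x * y)) = 0
      rw [d_mul i x hx, map_add, map_smul, d_mul (i + 1) _ (d_mem i x hx), d_mul i x hx, hx', hy',
        pow_succ]
      simp
  induction x using DirectSum.Decomposition.inductionOn (grading A) with
  | zero => simp
  | homogeneous x => exact (hN _ x.2).2
  | add x y hx hy => rw [map_add, map_add, hx, hy, add_zero]

end KaehlerForms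

/-- The algebra of Kähler differential forms of the commutative algebra `A`: the exterior algebra
over `A` of the module of Kähler differentials, with the differential which extends the universal
derivation. -/
def KaehlerForms : GradedDiffAlgebra.{u} where
  carrier := KaehlerForms.Carrier A
  grading := KaehlerForms.grading A
  d := KaehlerForms.d A
  d_mem := KaehlerForms.d_mem
  d_mul := KaehlerForms.d_mul
  d_d := KaehlerForms.d_d

/-- The canonical homomorphism of `A` onto the degree `0` part of the exterior algebra. -/
def KaehlerForms.ofA : A →ₐ[ℂ] KaehlerForms A :=
  IsScalarTower.toAlgHom ℂ A (KaehlerForms.Carrier A)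

end KaehlerForms

end

noncomputable section

open scoped TensorProduct
open KaehlerDifferential

variable (A : Type u) [CommRing A] [Algebra ℂ A]

/-! ### Isomorphisms of graded differential algebras -/

namespace GradedDiffAlgebra

/-! When $A$ is commutative, $Z(A) = A$, and the two kinds of generators of the ideal have the
following effect. The commutators $a\omega - \omega a$ identify the left and right actions on
one-forms, so that $d$ restricted to $A$ becomes a derivation into an $A$-module in the commutative
sense. Their differentials then force one-forms to anticommute: applying $d$ to $a\omega = \omega a$
and cancelling $a\,d\omega = d\omega\,a$ leaves $da\,\omega = -\omega\,da$, and the differentials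
$da$ span $\Omega^1_u(A)$ over $A$. As $2$ is invertible, one-forms square to zero. Hence
$\Omega_Z(A)$ is an $A$-algebra satisfying exactly the relations of the exterior algebra on Kähler
differentials.

The isomorphism is a pair of mutually inverse maps, each given by a universal property. The map $x
\otimes y \mapsto x\,dy$ restricts to a bimodule map from $\Omega^1_u(A)$ to the Kähler
differentials; it extends to the tensor algebra, commutes with $d$ (`UniversalForms.toKaehler_d`),
and therefore kills the ideal (`UniversalForms.toKaehler_eq_zero`). Conversely, the universal
derivation property and `CentralForms.of1_mul_self` give a map from the exterior algebra to
$\Omega_Z(A)$. The composites are identities because they fix $A$ and every $da$.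

Uniqueness has the same source: $A$ and $dA$ generate $\Omega_Z(A)$ (`CentralForms.hom_ext`), and a
morphism commuting with $d$ is determined on $dA$ by its values on $A$. -/

/-- Compatibility with degree and differential is a property, not data, so uniqueness can be checked
on algebra maps. -/
theorem Iso.toAlgEquiv_injective {Ω Ω' : GradedDiffAlgebra.{u}} :
    Function.Injective (Iso.toAlgEquiv : Iso Ω Ω' → Ω ≃ₐ[ℂ] Ω') := by
  rintro ⟨e, _, _⟩ ⟨f, _, _⟩ h
  cases h
  rfl

end GradedDiffAlgebra

/-! ### From universal one-forms to Kähler differentials -/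

namespace UniversalForms1

/-- The map `x ⊗ y ↦ x d y` to the Kähler differentials. -/
def tensorToKaehler : A ⊗[ℂ] A →ₗ[ℂ] Ω[A⁄ℂ] :=
  TensorProduct.lift
    (LinearMap.mk₂ ℂ (fun x y : A => x • D ℂ A y) (fun _ _ _ => add_smul _ _ _)
      (fun _ _ _ => smul_assoc _ _ _) (fun _ _ _ => by rw [map_add, smul_add])
      (fun c x y => by rw [Derivation.map_smul, smul_comm]))

/-- The bimodule homomorphism `∑ x d_u(y) ↦ ∑ x d y` from `Ω¹_u(A)` to the Kähler differentials. -/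
def toKaehler : UniversalForms1 A →ₗ[ℂ] Ω[A⁄ℂ] := (tensorToKaehler A).comp (incl A)

variable {A}

theorem tensorToKaehler_tmul (x y : A) : tensorToKaehler A (x ⊗ₜ y) = x • D ℂ A y := rfl

theorem tensorToKaehler_left (a : A) (t : A ⊗[ℂ] A) :
    tensorToKaehler A ((a ⊗ₜ 1) * t) = a • tensorToKaehler A t := by
  induction t with
  | zero => simp
  | tmul x y => simp [tensorToKaehler_tmul, mul_smul]
  | add s t hs ht => rw [mul_add, map_add, map_add, smul_add, hs, ht]

/-- By Leibniz, $x\,d(ya) = a\,x\,dy + xy\,da$. The error term carries the product of $t$ as its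
coefficient, so it vanishes on $\Omega^1_u(A)$: there the right action becomes the left one after
mapping to Kähler differentials. -/
theorem tensorToKaehler_right (a : A) (t : A ⊗[ℂ] A) :
    tensorToKaehler A (t * (1 ⊗ₜ a)) =
      a • tensorToKaehler A t + LinearMap.mul' ℂ A t • D ℂ A a := by
  induction t with
  | zero => simp
  | tmul x y =>
    rw [Algebra.TensorProduct.tmul_mul_tmul, mul_one, tensorToKaehler_tmul, tensorToKaehler_tmul,
      Derivation.leibniz, LinearMap.mul'_apply, smul_add, smul_smul, smul_comm x a, add_comm]
  | add s t hs ht =>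
    rw [add_mul, map_add, map_add, map_add, smul_add, add_smul, hs, ht, add_add_add_comm]

theorem toKaehler_smul (a : A) (ω : UniversalForms1 A) :
    toKaehler A (a • ω) = a • toKaehler A ω :=
  tensorToKaehler_left a _

theorem toKaehler_op_smul (a : A) (ω : UniversalForms1 A) :
    toKaehler A (MulOpposite.op a • ω) = a • toKaehler A ω :=
  (tensorToKaehler_right a _).trans (by rw [mul'_incl, zero_smul, add_zero]; rfl)

theorem toKaehler_d (a : A) : toKaehler A (d A a) = D ℂ A a := by
  change tensorToKaehler A (incl A (d A a)) = _
  rw [incl_d, map_sub, tensorToKaehler_tmul, tensorToKaehler_tmul, Derivation.map_one_eq_zero,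
    smul_zero, sub_zero, one_smul]

-- If $\sum xy = 0$, then $\sum x \otimes y = \sum x\,d_u y$, since $x\,d_u y = x \otimes y - xy
-- \otimes 1$. This reduces every statement that is linear over $A$ in a one-form to the exact forms
-- $d_u a$.
variable (A) in
theorem span_d : Submodule.span A (Set.range (d A)) = ⊤ := by
  -- Induction on tensors leaves the kernel of the product, so the claim is made for arbitrary `t`,
  -- with a correction term that is zero on the kernel.
  have key : ∀ t : A ⊗[ℂ] A, ∃ ω ∈ Submodule.span A (Set.range (d A)),
      incl A ω = t - LinearMap.mul' ℂ A t ⊗ₜ 1 := by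
    intro t
    induction t with
    | zero => exact ⟨0, zero_mem _, by simp⟩
    | tmul x y =>
      exact ⟨x • d A y, Submodule.smul_mem _ _ (Submodule.subset_span ⟨y, rfl⟩),
        by simp [incl_smul, incl_d, mul_sub]⟩
    | add s t hs ht =>
      obtain ⟨ω, h1, h2⟩ := hs
      obtain ⟨η, h3, h4⟩ := ht
      exact ⟨ω + η, add_mem h1 h3, by
        rw [map_add, h2, h4, map_add, TensorProduct.add_tmul]; abel⟩
  refine eq_top_iff.2 fun ω _ => ?_
  obtain ⟨η, h1, h2⟩ := key (incl A ω)
  rw [mul'_incl, TensorProduct.zero_tmul, sub_zero] at h2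
  rwa [← incl_injective h2]

end UniversalForms1

/-! ### The morphism from the universal calculus to Kähler forms -/

namespace UniversalForms

/-- The homomorphism of `Ω_u(A)` onto the algebra of Kähler forms. -/
def toKaehler : UniversalForms A →ₐ[ℂ] KaehlerForms A :=
  BimoduleTensorAlgebra.lift (B := KaehlerForms.Carrier A) (KaehlerForms.ofA A)
    (((KaehlerForms.of1 A).restrictScalars ℂ).comp (UniversalForms1.toKaehler A))
    (fun a ω => by
      change KaehlerForms.of1 A _ = algebraMap A (KaehlerForms.Carrier A) a * KaehlerForms.of1 A _
      rw [UniversalForms1.toKaehler_smul, map_smul, Algebra.smul_def])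
    -- Both actions on $\Omega^1_u(A)$ become the same scalar multiplication, and scalars from $A$
    -- are central in the exterior algebra.
    (fun a ω => by
      change KaehlerForms.of1 A _ = KaehlerForms.of1 A _ * algebraMap A (KaehlerForms.Carrier A) a
      rw [UniversalForms1.toKaehler_op_smul, map_smul, Algebra.smul_def, Algebra.commutes])

variable {A}

theorem toKaehler_ofA (a : A) : toKaehler A (ofA A a) = KaehlerForms.ofA A a :=
  BimoduleTensorAlgebra.lift_ofAlg (B := KaehlerForms.Carrier A) ..

theorem toKaehler_of1 (ω : UniversalForms1 A) :
    toKaehler A (of1 A ω) = KaehlerForms.of1 A (UniversalForms1.toKaehler A ω) :=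
  BimoduleTensorAlgebra.lift_ofMod (B := KaehlerForms.Carrier A) ..

theorem toKaehler_mem (n : ℕ) (x : UniversalForms A) (hx : x ∈ (UniversalForms A).grading n) :
    toKaehler A x ∈ (KaehlerForms A).grading n := by
  refine BimoduleTensorAlgebra.grading_le
    (fun n => ((KaehlerForms A).grading n).comap (toKaehler A).toLinearMap) ?_ ?_ ?_ n hx
  · intro a
    change toKaehler A (ofA A a) ∈ (KaehlerForms A).grading 0
    rw [toKaehler_ofA]
    exact KaehlerForms.algebraMap_mem a
  · intro ω
    change toKaehler A (of1 A ω) ∈ (KaehlerForms A).grading 1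
    rw [toKaehler_of1]
    exact KaehlerForms.of1_mem _
  · intro i j x hx y hy
    exact (congrArg (· ∈ (KaehlerForms A).grading (i + j)) (map_mul (toKaehler A) x y)).mpr
      (SetLike.GradedMul.mul_mem (A := (KaehlerForms A).grading) hx hy)

/-- Both sides are restrictions of maps defined on all of $A \otimes A$, which already agree on pure
tensors: $d(x\,dy) = dx \wedge dy$. -/
theorem toKaehler_d1 (ω : UniversalForms1 A) :
    toKaehler A (d1 A ω) = KaehlerForms.d1 A (UniversalForms1.toKaehler A ω) := by
  change toKaehler A (dTensor A (UniversalForms1.incl A ω)) =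
    KaehlerForms.d1 A (UniversalForms1.tensorToKaehler A (UniversalForms1.incl A ω))
  induction UniversalForms1.incl A ω with
  | zero => exact (map_zero (toKaehler A)).trans (by simp; rfl)
  | tmul x y =>
    rw [dTensor_tmul, UniversalForms1.tensorToKaehler_tmul, KaehlerForms.d1_smul,
      KaehlerForms.d1_D, smul_zero, add_zero]
    refine (map_mul (toKaehler A) _ _).trans ?_
    rw [toKaehler_of1, toKaehler_of1, UniversalForms1.toKaehler_d, UniversalForms1.toKaehler_d]
    rfl
  | add s t hs ht =>
    rw [map_add, map_add, map_add, ← hs, ← ht]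
    exact map_add (toKaehler A) _ _

theorem toKaehler_d (x : UniversalForms A) :
    toKaehler A ((UniversalForms A).d x) = (KaehlerForms A).d (toKaehler A x) := by
  -- The sign in the antiderivation rule depends on the degree of the left factor, so membership in
  -- degree `n` is carried along with the equality to make the family multiplicative.
  let N (n : ℕ) : Submodule ℂ (UniversalForms A) := (UniversalForms A).grading n ⊓
    LinearMap.eqLocus ((toKaehler A).toLinearMap.comp (UniversalForms A).d)
      ((KaehlerForms A).d.comp (toKaehler A).toLinearMap)
  have hN : ∀ n, (UniversalForms A).grading n ≤ N n := by
    intro n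
    refine BimoduleTensorAlgebra.grading_le N
      (fun a => ⟨BimoduleTensorAlgebra.ofAlg_mem a, ?_⟩)
      (fun ω => ⟨BimoduleTensorAlgebra.ofMod_mem ω, ?_⟩) ?_ n
    · change toKaehler A (d A (ofA A a)) = KaehlerForms.d A (toKaehler A (ofA A a))
      rw [d_ofA, toKaehler_of1, toKaehler_ofA, UniversalForms1.toKaehler_d]
      exact (KaehlerForms.d_algebraMap a).symm
    · change toKaehler A (d A (of1 A ω)) = KaehlerForms.d A (toKaehler A (of1 A ω))
      rw [d_of1, toKaehler_of1, toKaehler_d1]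
      exact (KaehlerForms.d_of1 _).symm
    · rintro i j (x : UniversalForms A) ⟨hx, hx'⟩ (y : UniversalForms A) ⟨hy, hy'⟩
      replace hx' : toKaehler A ((UniversalForms A).d x) = (KaehlerForms A).d (toKaehler A x) := hx'
      replace hy' : toKaehler A ((UniversalForms A).d y) = (KaehlerForms A).d (toKaehler A y) := hy'
      have hxy := SetLike.GradedMul.mul_mem (A := (UniversalForms A).grading) hx hy
      refine ⟨hxy, ?_⟩
      change toKaehler A ((UniversalForms A).d (x * y)) = (KaehlerForms A).d (toKaehler A (x * y))
      rw [(UniversalForms A).d_mul i x hx, map_mul,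
        (KaehlerForms A).d_mul i _ (toKaehler_mem i x hx), map_add, map_smul, map_mul, map_mul,
        hx', hy']
  induction x using DirectSum.Decomposition.inductionOn (UniversalForms A).grading with
  | zero => simp
  | homogeneous x => exact (hN _ x.2).2
  | add x y hx hy => simp only [map_add, hx, hy]

theorem toKaehler_eq_zero {x : UniversalForms A}
    (hx : x ∈ (UniversalForms A).closedIdeal (centralCommutators A)) : toKaehler A x = 0 := by
  have h : ∀ s ∈ centralCommutators A, toKaehler A s = 0 := by
    rintro _ ⟨z, -, ω, rfl⟩
    rw [toKaehler_of1, map_sub, UniversalForms1.toKaehler_smul,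
      UniversalForms1.toKaehler_op_smul, sub_self, map_zero]
    rfl
  have hle : TwoSidedIdeal.span (centralCommutators A ∪
      (UniversalForms A).d '' centralCommutators A) ≤ TwoSidedIdeal.ker (toKaehler A) := by
    rw [TwoSidedIdeal.span_le]
    rintro x (hx | ⟨x, hx, rfl⟩)
    · exact (TwoSidedIdeal.mem_ker _).2 (h x hx)
    -- Generators of the form $ds$ need no computation: the map commutes with $d$ and kills $s$.
    · refine (TwoSidedIdeal.mem_ker _).2 ?_
      rw [toKaehler_d, h x hx, map_zero]
  exact (TwoSidedIdeal.mem_ker _).1 (hle hx)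

end UniversalForms

/-! ### The quotient calculus and its generators -/

namespace CentralForms

/-- The quotient map `Ω_u(A) → Ω_Z(A)`. -/
def mk : UniversalForms A →ₐ[ℂ] CentralForms A :=
  (UniversalForms A).quotMk (centralCommutators A)

/-- The image of `Ω¹_u(A)` in `Ω_Z(A)`. -/
def of1 : UniversalForms1 A →ₗ[ℂ] CentralForms A :=
  (mk A).toLinearMap.comp (UniversalForms.of1 A)

variable {A}

theorem mk_surjective : Function.Surjective (mk A) :=
  (UniversalForms A).quotMk_surjective _

theorem mk_mem {n : ℕ} {x : UniversalForms A} (hx : x ∈ (UniversalForms A).grading n) :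
    mk A x ∈ (CentralForms A).grading n :=
  ⟨x, hx, rfl⟩

theorem ofA_mem (a : A) : ofA A a ∈ (CentralForms A).grading 0 :=
  mk_mem (BimoduleTensorAlgebra.ofAlg_mem a)

theorem of1_mem (ω : UniversalForms1 A) : of1 A ω ∈ (CentralForms A).grading 1 :=
  mk_mem (BimoduleTensorAlgebra.ofMod_mem ω)

theorem d_ofA (a : A) : (CentralForms A).d (ofA A a) = of1 A (UniversalForms1.d A a) :=
  congrArg (mk A) (UniversalForms.d_ofA a)

theorem of1_smul (a : A) (ω : UniversalForms1 A) : of1 A (a • ω) = ofA A a * of1 A ω :=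
  (congrArg (mk A) (BimoduleTensorAlgebra.ofMod_smul a ω)).trans (map_mul (mk A) _ _)

theorem of1_op_smul (a : A) (ω : UniversalForms1 A) :
    of1 A (MulOpposite.op a • ω) = of1 A ω * ofA A a :=
  (congrArg (mk A) (BimoduleTensorAlgebra.ofMod_op_smul a ω)).trans (map_mul (mk A) _ _)

/-- This is where $Z(A) = A$ enters: every commutator $a\omega - \omega a$ is a generator of the
ideal. -/
theorem ofA_mul_of1 (a : A) (ω : UniversalForms1 A) : ofA A a * of1 A ω = of1 A ω * ofA A a := by
  have h : mk A (UniversalForms.of1 A (a • ω - MulOpposite.op a • ω)) = 0 :=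
    ((UniversalForms A).quotMk_eq_zero _).2 (TwoSidedIdeal.subset_span
      (Or.inl ⟨a, Subalgebra.mem_center_iff.2 fun b => mul_comm b a, ω, rfl⟩))
  change of1 A _ = 0 at h
  rwa [map_sub, of1_smul, of1_op_smul, sub_eq_zero] at h

/-- Two homomorphisms from `Ω_Z(A)` agree if they agree on `A` and on `d A`. -/
theorem hom_ext {B : Type*} [Ring B] [Algebra ℂ B] {f g : CentralForms A →ₐ[ℂ] B}
    (h : ∀ a, f (ofA A a) = g (ofA A a))
    (hd : ∀ a, f ((CentralForms A).d (ofA A a)) = g ((CentralForms A).d (ofA A a))) : f = g := by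
  have key : f.comp (mk A) = g.comp (mk A) := by
    -- After lifting to the tensor algebra only one-forms remain, and these are combinations of
    -- terms $a\,db$.
    refine BimoduleTensorAlgebra.hom_ext h fun ω => ?_
    change f (of1 A ω) = g (of1 A ω)
    have hω : ω ∈ Submodule.span A (Set.range (UniversalForms1.d A)) := by
      rw [UniversalForms1.span_d]; trivial
    induction hω using Submodule.span_induction with
    | mem ω hω =>
      obtain ⟨a, rfl⟩ := hω
      rw [← d_ofA, hd]
    | zero => simp
    | add ω η _ _ hω hη => simp only [map_add, hω, hη]
    | smul a ω _ hω => rw [of1_smul, map_mul, map_mul, h, hω]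
  ext x
  obtain ⟨x, rfl⟩ := mk_surjective x
  exact DFunLike.congr_fun key x

/-! ### Centrality of functions and anticommutation of one-forms -/

/-- Commuting with $A$ and with one-forms suffices, since these generate. Centrality in all degrees
is what makes $\Omega_Z(A)$ an $A$-algebra; it also covers the two-form $d\omega$ in the next
argument. -/
theorem ofA_commute (a : A) (x : CentralForms A) : ofA A a * x = x * ofA A a := by
  obtain ⟨x, rfl⟩ := mk_surjective x
  induction x using BimoduleTensorAlgebra.induction with
  | hA b =>
    change ofA A a * ofA A b = ofA A b * ofA A a
    rw [← map_mul, mul_comm, map_mul]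
  | hM ω => exact ofA_mul_of1 a ω
  | hadd x y hx hy => erw [map_add (mk A)]; rw [mul_add, add_mul, hx, hy]
  | hmul x y hx hy => erw [map_mul (mk A)]; rw [← mul_assoc, hx, mul_assoc, hy, mul_assoc]

/-- Differentiating $a\omega = \omega a$ gives $da\,\omega + a\,d\omega = d\omega\,a - \omega\,da$,
and the terms containing $d\omega$ cancel by centrality of $a$. The differential exists on the
quotient because the ideal also contains the differentials of the commutators. -/
theorem of1_d_anticomm (a : A) (ω : UniversalForms1 A) :
    of1 A (UniversalForms1.d A a) * of1 A ω = -(of1 A ω * of1 A (UniversalForms1.d A a)) := by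
  have h := congrArg (CentralForms A).d (ofA_mul_of1 a ω)
  rw [(CentralForms A).d_mul 0 _ (ofA_mem a), (CentralForms A).d_mul 1 _ (of1_mem ω), d_ofA,
    pow_zero, one_smul, pow_one, neg_smul, one_smul, ofA_commute, add_comm] at h
  exact add_left_cancel h

/-- Anticommutation with a fixed $\eta$ is an $A$-linear condition on $\omega$, as functions are
central, so the case $\omega = da$ is enough. -/
theorem of1_anticomm (ω η : UniversalForms1 A) : of1 A ω * of1 A η = -(of1 A η * of1 A ω) := by
  have hω : ω ∈ Submodule.span A (Set.range (UniversalForms1.d A)) := by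
    rw [UniversalForms1.span_d]; trivial
  induction hω using Submodule.span_induction with
  | mem ω hω =>
    obtain ⟨a, rfl⟩ := hω
    exact of1_d_anticomm a η
  | zero => simp
  | add ω ω' _ _ h h' => rw [map_add, add_mul, mul_add, h, h', neg_add]
  | smul a ω _ h => rw [of1_smul, mul_assoc, h, mul_neg, ← mul_assoc, ofA_commute, mul_assoc]

theorem of1_mul_self (ω : UniversalForms1 A) : of1 A ω * of1 A ω = 0 := by
  -- Anticommutation of $\omega$ with itself only gives $2\omega^2 = 0$; invertibility of $2$ in
  -- $\mathbb C$ finishes.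
  have h : (2 : ℂ) • (of1 A ω * of1 A ω) = 0 := by
    rw [two_smul]
    exact add_eq_zero_iff_eq_neg.2 (of1_anticomm ω ω)
  exact (smul_eq_zero_iff_right two_ne_zero).1 h

/-! ### The $A$-algebra structure and the induced derivation -/

instance : Algebra A (CentralForms A) :=
  (ofA A).toRingHom.toAlgebra' ofA_commute

theorem smul_eq_mul (a : A) (x : CentralForms A) : a • x = ofA A a * x := rfl

instance : IsScalarTower ℂ A (CentralForms A) :=
  .of_algebraMap_eq fun c => ((ofA A).commutes c).symm

variable (A)

/-- The differential of `Ω_Z(A)` on `A`, as a derivation. -/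
def derivation : Derivation ℂ A (CentralForms A) :=
  Derivation.mk' ((CentralForms A).d.comp (ofA A).toLinearMap) fun a b => by
    change (CentralForms A).d (ofA A (a * b)) =
      a • (CentralForms A).d (ofA A b) + b • (CentralForms A).d (ofA A a)
    -- In degree $0$ the antiderivation rule has no sign and reads $d(ab) = da\,b + a\,db$;
    -- centrality turns $da\,b$ into $b\,da$.
    rw [map_mul, (CentralForms A).d_mul 0 _ (ofA_mem a), pow_zero, one_smul, smul_eq_mul,
      smul_eq_mul, ofA_commute b, add_comm]

variable {A}

theorem lift_derivation_D (a : A) :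
    (derivation A).liftKaehlerDifferential (D ℂ A a) = of1 A (UniversalForms1.d A a) := by
  rw [Derivation.liftKaehlerDifferential_comp_D]
  exact d_ofA a

/-- The lifted derivation takes values in all of $\Omega_Z(A)$. Locating them in the image of
$\Omega^1_u(A)$ shows that they have degree $1$ and square to zero, the latter being the condition
for extending to the exterior algebra. -/
theorem lift_derivation_mem (ω : Ω[A⁄ℂ]) :
    ∃ η, (derivation A).liftKaehlerDifferential ω = of1 A η := by
  have hω : ω ∈ Submodule.span A (Set.range (D ℂ A)) := by
    rw [span_range_derivation]; trivial
  induction hω using Submodule.span_induction with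
  | mem ω hω =>
    obtain ⟨a, rfl⟩ := hω
    exact ⟨_, lift_derivation_D a⟩
  | zero => exact ⟨0, by simp⟩
  | add ω ω' _ _ h h' =>
    obtain ⟨η, h⟩ := h
    obtain ⟨η', h'⟩ := h'
    exact ⟨η + η', by rw [map_add, map_add, h, h']⟩
  | smul a ω _ h =>
    obtain ⟨η, h⟩ := h
    exact ⟨a • η, by rw [map_smul, h, of1_smul, smul_eq_mul]⟩

/-! ### The two mutually inverse homomorphisms -/

variable (A)

/-- The homomorphism of `Ω_Z(A)` onto the algebra of Kähler forms. -/
def toKaehler : CentralForms A →ₐ[ℂ] KaehlerForms A :=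
  Ideal.Quotient.liftₐ ((UniversalForms A).closedIdeal (centralCommutators A))
    (UniversalForms.toKaehler A) fun _ hx => UniversalForms.toKaehler_eq_zero hx

/-- The homomorphism of the exterior algebra into `Ω_Z(A)` which extends the derivation
`A → Ω_Z(A)`. -/
def ofKaehlerLinear : KaehlerForms.Carrier A →ₐ[A] CentralForms A :=
  ExteriorAlgebra.lift A ⟨(derivation A).liftKaehlerDifferential, fun ω => by
    obtain ⟨η, h⟩ := lift_derivation_mem ω
    rw [h, of1_mul_self]⟩

/-- The inverse of `toKaehler`. -/
def ofKaehler : KaehlerForms A →ₐ[ℂ] CentralForms A :=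
  (ofKaehlerLinear A).restrictScalars ℂ

variable {A}

theorem toKaehler_ofA (a : A) : toKaehler A (ofA A a) = KaehlerForms.ofA A a :=
  UniversalForms.toKaehler_ofA a

theorem toKaehler_of1 (ω : UniversalForms1 A) :
    toKaehler A (of1 A ω) = KaehlerForms.of1 A (UniversalForms1.toKaehler A ω) :=
  UniversalForms.toKaehler_of1 ω

theorem toKaehler_mem (n : ℕ) (x : CentralForms A) (hx : x ∈ (CentralForms A).grading n) :
    toKaehler A x ∈ (KaehlerForms A).grading n := by
  obtain ⟨x, hx, rfl⟩ := hx
  exact UniversalForms.toKaehler_mem n x hx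

theorem toKaehler_d (x : CentralForms A) :
    toKaehler A ((CentralForms A).d x) = (KaehlerForms A).d (toKaehler A x) := by
  obtain ⟨x, rfl⟩ := mk_surjective x
  exact UniversalForms.toKaehler_d x

theorem ofKaehler_ofA (a : A) : ofKaehler A (KaehlerForms.ofA A a) = ofA A a :=
  (ofKaehlerLinear A).commutes a

theorem ofKaehler_of1 (ω : Ω[A⁄ℂ]) :
    ofKaehler A (KaehlerForms.of1 A ω) = (derivation A).liftKaehlerDifferential ω :=
  ExteriorAlgebra.lift_ι_apply ..

theorem ofKaehler_mem (n : ℕ) (x : KaehlerForms A) (hx : x ∈ (KaehlerForms A).grading n) :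
    ofKaehler A x ∈ (CentralForms A).grading n := by
  refine KaehlerForms.grading_le
    (fun n => ((CentralForms A).grading n).comap (ofKaehler A).toLinearMap) ?_ ?_ ?_ n hx
  · intro a
    change ofKaehler A (KaehlerForms.ofA A a) ∈ (CentralForms A).grading 0
    rw [ofKaehler_ofA]
    exact ofA_mem a
  · intro ω
    change ofKaehler A (KaehlerForms.of1 A ω) ∈ (CentralForms A).grading 1
    obtain ⟨η, h⟩ := lift_derivation_mem ω
    rw [ofKaehler_of1, h]
    exact of1_mem η
  · intro i j x hx y hy
    exact (congrArg (· ∈ (CentralForms A).grading (i + j)) (map_mul (ofKaehler A) x y)).mpr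
      (SetLike.GradedMul.mul_mem (A := (CentralForms A).grading) hx hy)

/-- It suffices to follow $a$ and $da$. The latter goes to the Kähler differential of $a$ and back
to the class of $d_u a$. -/
theorem ofKaehler_comp_toKaehler : (ofKaehler A).comp (toKaehler A) = AlgHom.id ℂ _ := by
  refine hom_ext (fun a => ?_) fun a => ?_
  · rw [AlgHom.comp_apply, toKaehler_ofA, ofKaehler_ofA, AlgHom.id_apply]
  · rw [AlgHom.comp_apply, d_ofA, toKaehler_of1, ofKaehler_of1, UniversalForms1.toKaehler_d,
      lift_derivation_D, AlgHom.id_apply]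

theorem toKaehler_ofKaehler (x : KaehlerForms A) : toKaehler A (ofKaehler A x) = x := by
  induction x using ExteriorAlgebra.induction with
  | algebraMap a => exact (congrArg (toKaehler A) (ofKaehler_ofA a)).trans (toKaehler_ofA a)
  | ι ω =>
    change toKaehler A (ofKaehler A (KaehlerForms.of1 A ω)) = KaehlerForms.of1 A ω
    rw [ofKaehler_of1]
    -- The composite fixes functions, so on one-forms it is $A$-linear and can be tested on the
    -- universal differentials.
    have hω : ω ∈ Submodule.span A (Set.range (D ℂ A)) := by
      rw [span_range_derivation]; trivial
    induction hω using Submodule.span_induction with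
    | mem ω hω =>
      obtain ⟨a, rfl⟩ := hω
      rw [lift_derivation_D, toKaehler_of1, UniversalForms1.toKaehler_d]
    | zero => rw [map_zero, map_zero, map_zero]; rfl
    | add ω η _ _ h h' => rw [map_add, map_add, map_add, h, h']; rfl
    | smul a ω _ h =>
      rw [(derivation A).liftKaehlerDifferential.map_smul, smul_eq_mul, map_mul, toKaehler_ofA, h,
        map_smul, Algebra.smul_def]
      rfl
  | add x y hx hy =>
    exact (congrArg (toKaehler A) (map_add (ofKaehler A) x y)).trans
      ((map_add (toKaehler A) _ _).trans (congrArg₂ (· + ·) hx hy))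
  | mul x y hx hy =>
    exact (congrArg (toKaehler A) (map_mul (ofKaehler A) x y)).trans
      ((map_mul (toKaehler A) _ _).trans (congrArg₂ (· * ·) hx hy))

theorem ofKaehler_toKaehler (x : CentralForms A) : ofKaehler A (toKaehler A x) = x :=
  DFunLike.congr_fun ofKaehler_comp_toKaehler x

variable (A)

/-- The isomorphism of `Ω_Z(A)` with the algebra of Kähler forms. -/
def kaehlerIso : GradedDiffAlgebra.Iso (CentralForms A) (KaehlerForms A) where
  toAlgEquiv := AlgEquiv.ofAlgHom (toKaehler A) (ofKaehler A)
    (AlgHom.ext toKaehler_ofKaehler) ofKaehler_comp_toKaehler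
  -- The converse implication comes from the inverse preserving degree. For the differential one
  -- direction is enough, so the inverse is never separately shown to commute with $d$.
  map_mem n x := ⟨toKaehler_mem n x, fun h => by
    rw [← ofKaehler_toKaehler x]
    exact ofKaehler_mem n _ h⟩
  map_d := toKaehler_d

end CentralForms

end

/-! ### Existence and uniqueness -/

theorem corollary4 (A : Type u) [CommRing A] [Algebra ℂ A] :
    ∃! e : GradedDiffAlgebra.Iso (CentralForms A) (KaehlerForms A),
      ∀ a : A, e (CentralForms.ofA A a) = KaehlerForms.ofA A a := by
  refine ⟨CentralForms.kaehlerIso A, CentralForms.toKaehler_ofA, fun e he => ?_⟩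
  refine GradedDiffAlgebra.Iso.toAlgEquiv_injective (AlgEquiv.coe_toAlgHom_injective ?_)
  refine CentralForms.hom_ext (fun a => ?_) fun a => ?_
  · exact (he a).trans (CentralForms.toKaehler_ofA a).symm
  -- On exact one-forms the values are forced: $e(da) = d(e(a))$, and $e(a)$ is prescribed.
  · refine (e.map_d _).trans (Eq.trans ?_ (CentralForms.toKaehler_d _).symm)
    exact congrArg (KaehlerForms A).d ((he a).trans (CentralForms.toKaehler_ofA a).symm)
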